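/- Let $R$ be an artinian local ring with maximal ideal $\mathfrak m$ and perfect residue field $k=R/\mathfrak m$ of characteristic $p>0$; write $(-)_0$ for base change from $R$ to $k$. Let $T$ be an $R$-torus (a commutative $R$-group scheme that is étale locally on $R$ isomorphic to some $\mathbb G_m^d$) and let $L$ be a lattice over $R$ (a commutative $R$-group scheme that is étale locally on $R$ isomorphic to some constant group $\mathbb Z^r$). Put $T[p^\infty]=\varinjlim_n T[p^n]$ and $L[p^\infty]=L\otimes_{\mathbb Z}\mathbb Q_p/\mathbb Z_p=\varinjlim_n L/p^nL$ (transition maps induced by multiplication by $p$), as fppf sheaves of abelian groups over $R$. For a homomorphism $u\colon L\to T$, the Barsotti–Tate group of the $1$-motive $M=[u\colon L\to T]$ is $M[p^\infty]=\varinjlim_n M[p^n]$, where $$M[m]=H\Bigl(L\xrightarrow{\binom{-u}{-m}}T\oplus L\xrightarrow{(-m,\,u)}T\Bigr)$$ is the homology at $T\oplus L$ and the transition map $M[p^n]\to M[p^{n+1}]$ is induced by $(g,x)\mapsto(g,px)$; the maps $g\mapsto(g,0)$ and $(g,x)\mapsto x$ make it an extension $$0\to T[p^\infty]\to M[p^\infty]\to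 L[p^\infty]\to 0 .$$ Then for every $1$-motive $M_0=[u_0\colon L_0\to T_0]$ over $k$ and every Barsotti–Tate group $\mathcal B$ over $R$ given as an extension $0\to T[p^\infty]\to\mathcal B\to L[p^\infty]\to 0$ of fppf sheaves, there is a unique $1$-motive $M=[u\colon L\to T]$ over $R$ (that is, a unique homomorphism $u\colon L\to T$) which lifts $M_0$ (that is, whose reduction modulo $\mathfrak m$ is $u_0$) and whose Barsotti–Tate group $M[p^\infty]$ is isomorphic to $\mathcal B$ as an extension of $L[p^\infty]$ by $T[p^\infty]$. -/

import Mathlib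

open CategoryTheory Limits AlgebraicGeometry Opposite

universe u

noncomputable section

namespace OneMotive

/-! ### Commutative group sheaves on the big fppf site -/

/-- Sheaves of abelian groups on the big fppf site of schemes over `S`. Commutative group schemes
over `S` are regarded as objects of this category through their functors of points. -/
abbrev FppfAb (S : Scheme.{u}) : Type (u + 2) :=
  Sheaf (Scheme.fppfTopology.{u}.over S) AddCommGrpCat.{u + 1}

/-- Base change along `f : S' ⟶ S`: the sheaf `F` is restricted to the `S`-schemes whose structure
morphism comes with a factorization through `f`. For the sheaf of points of an `S`-group scheme `G`
the result is the sheaf of points of the `S'`-group scheme `G ×_S S'`. -/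
abbrev baseChange {S' S : Scheme.{u}} (f : S' ⟶ S) : FppfAb S ⥤ FppfAb S' :=
  Scheme.fppfTopology.{u}.overMapPullback AddCommGrpCat.{u + 1} f

/-! ### The multiplicative group, tori and lattices -/

/-- The presheaf of abelian groups `X ↦ Γ(X, 𝒪_X)ˣ` (written additively) on schemes. -/
def unitsPresheaf : Scheme.{u}ᵒᵖ ⥤ AddCommGrpCat.{u} :=
  Scheme.Γ ⋙ forget₂ CommRingCat CommMonCat ⋙ CommMonCat.units ⋙ CommGrpCat.toAddCommGrp

/-- Ring homomorphisms out of `ℤ[t, t⁻¹]` are units. -/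
def laurentHomEquiv (A : Type u) [CommRing A] :
    (LaurentPolynomial (ULift.{u} ℤ) →+* A) ≃ Aˣ where
  toFun φ := Units.map (φ : LaurentPolynomial (ULift.{u} ℤ) →* A)
    ⟨LaurentPolynomial.T 1, LaurentPolynomial.T (-1),
      by rw [← LaurentPolynomial.T_add, add_neg_cancel, LaurentPolynomial.T_zero],
      by rw [← LaurentPolynomial.T_add, neg_add_cancel, LaurentPolynomial.T_zero]⟩
  invFun a := LaurentPolynomial.eval₂ ((Int.castRingHom A).comp ULift.ringEquiv.toRingHom) a
  left_inv φ := by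
    apply IsLocalization.ringHom_ext (Submonoid.powers (Polynomial.X (R := ULift.{u} ℤ)))
    ext x
    · have h : φ.comp (LaurentPolynomial.C.comp ULift.ringEquiv.symm.toRingHom) =
          Int.castRingHom A := RingHom.ext_int _ _
      have h' := (RingHom.congr_fun h x.down).symm
      simp only [RingHom.comp_apply] at h'
      rw [RingHom.comp_apply, RingHom.comp_apply, RingHom.comp_apply, RingHom.comp_apply,
        LaurentPolynomial.algebraMap_eq_toLaurent, Polynomial.toLaurent_C, LaurentPolynomial.eval₂_C,
        RingHom.comp_apply]
      exact h'
    · simp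
  right_inv a := by
    ext
    simp

/-- The functor of units is represented by `Spec ℤ[t, t⁻¹]`. -/
def unitsPresheafRepresentableBy :
    (unitsPresheaf.{u} ⋙ forget AddCommGrpCat.{u}).RepresentableBy
      (Spec (CommRingCat.of (LaurentPolynomial (ULift.{u} ℤ)))) where
  homEquiv {X} := ((ΓSpec.adjunction.homEquiv X
      (op (CommRingCat.of (LaurentPolynomial (ULift.{u} ℤ))))).symm.trans
        (opEquiv _ _)).trans
      ((ConcreteCategory.homEquiv (C := CommRingCat)).trans ((laurentHomEquiv Γ(X, ⊤)).trans Additive.ofMul))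
  homEquiv_comp {X X'} f g := by
    apply Additive.toMul.injective
    apply Units.ext
    have h := congr_arg Quiver.Hom.unop (ΓSpec.adjunction.homEquiv_naturality_left_symm f g)
    exact RingHom.congr_fun (congr_arg CommRingCat.Hom.hom h) (LaurentPolynomial.T 1)

theorem isSheaf_unitsPresheaf :
    Presheaf.IsSheaf Scheme.fppfTopology.{u} unitsPresheaf.{u} := by
  apply Presheaf.isSheaf_of_isSheaf_comp _ _ (forget AddCommGrpCat.{u})
  rw [isSheaf_iff_isSheaf_of_type]
  have := unitsPresheafRepresentableBy.{u}.isRepresentable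
  exact GrothendieckTopology.Subcanonical.isSheaf_of_isRepresentable _

/-- The multiplicative group `𝔾_m` over `S`, with `𝔾_m(X) = Γ(X, 𝒪_X)ˣ`. -/
def Gm (S : Scheme.{u}) : FppfAb S :=
  (Scheme.fppfTopology.{u}.overPullback AddCommGrpCat.{u + 1} S).obj
    ((sheafCompose _ AddCommGrpCat.uliftFunctor.{u + 1, u}).obj
      ⟨unitsPresheaf.{u}, isSheaf_unitsPresheaf⟩)

/-- The split torus `𝔾_m^d` over `S`. -/
def splitTorus (S : Scheme.{u}) (d : ℕ) : FppfAb S :=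
  ∏ᶜ fun _ : Fin d => Gm S

/-- The constant group `ℤ^r` over `S`. -/
def constLattice (S : Scheme.{u}) (r : ℕ) : FppfAb S :=
  (constantSheaf (Scheme.fppfTopology.{u}.over S) AddCommGrpCat.{u + 1}).obj
    (AddCommGrpCat.of (ULift.{u + 1} (Fin r → ℤ)))

/-- An `S`-torus: a commutative group which is, locally for the étale topology on `S`, isomorphic
to some `𝔾_m^d`. (Such a sheaf is automatically a group scheme.) -/
def IsTorus {S : Scheme.{u}} (T : FppfAb S) : Prop :=
  ∀ s : S, ∃ (U : Scheme.{u}) (f : U ⟶ S), Etale f ∧ s ∈ Set.range f ∧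
    ∃ d : ℕ, Nonempty ((baseChange f).obj T ≅ splitTorus U d)

/-- A lattice over `S`: a commutative group which is, locally for the étale topology on `S`,
isomorphic to some `ℤ^r`. (Such a sheaf is automatically a group scheme.) -/
def IsLattice {S : Scheme.{u}} (L : FppfAb S) : Prop :=
  ∀ s : S, ∃ (U : Scheme.{u}) (f : U ⟶ S), Etale f ∧ s ∈ Set.range f ∧
    ∃ r : ℕ, Nonempty ((baseChange f).obj L ≅ constLattice U r)

/-! ### Barsotti-Tate groups -/

section

variable {S : Scheme.{u}} (p : ℕ)

/-- The kernel `G[m]` of multiplication by `m`. -/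
abbrev torsion (G : FppfAb S) (m : ℕ) : FppfAb S :=
  kernel (m • 𝟙 G)

/-- The inclusion `G[m] ⟶ G`. -/
def torsionι (G : FppfAb S) (m : ℕ) : torsion G m ⟶ G :=
  kernel.ι (m • 𝟙 G)

theorem torsionι_smul (G : FppfAb S) (m : ℕ) : m • torsionι G m = 0 := by
  have h : torsionι G m ≫ (m • 𝟙 G) = 0 := kernel.condition _
  simpa using h

/-- The inclusion `G[p^r] ⟶ G[p^(r+1)]`. -/
def torsionStep (G : FppfAb S) (r : ℕ) : torsion G (p ^ r) ⟶ torsion G (p ^ (r + 1)) :=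
  kernel.lift _ (torsionι G (p ^ r)) (by
    rw [Preadditive.comp_nsmul, Category.comp_id, pow_succ', mul_smul, torsionι_smul, smul_zero])

theorem torsionStep_ι (G : FppfAb S) (r : ℕ) :
    torsionStep p G r ≫ torsionι G (p ^ (r + 1)) = torsionι G (p ^ r) :=
  kernel.lift_ι _ _ _

/-- The system of inclusions `G[1] ⟶ G[p] ⟶ G[p^2] ⟶ ⋯`. -/
def torsionSystem (G : FppfAb S) : ℕ ⥤ FppfAb S :=
  Functor.ofSequence (X := fun r => torsion G (p ^ r)) (torsionStep p G)

/-- The `p`-power torsion subgroup `G[p^∞] = colim_r G[p^r]`. -/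
def pTorsion (G : FppfAb S) : FppfAb S :=
  colimit (torsionSystem p G)

/-- The canonical morphism `G[p^∞] ⟶ G`. -/
def pTorsionι (G : FppfAb S) : pTorsion p G ⟶ G :=
  colimit.desc (torsionSystem p G)
    ⟨G, NatTrans.ofSequence (fun r => torsionι G (p ^ r)) (by
      intro r
      simp only [torsionSystem, Functor.ofSequence_map_homOfLE_succ]
      exact (torsionStep_ι p G r).trans (Category.comp_id _).symm)⟩

/-- A Barsotti-Tate group over `S`: an abelian fppf sheaf `B` which is of `p`-power torsion, is
`p`-divisible, and for which every `B[p^n]` is a finite locally free group scheme. -/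
structure IsBTGroup (B : FppfAb S) : Prop where
  isIso_pTorsionι : IsIso (pTorsionι p B)
  epi_smul : Epi (p • 𝟙 B)
  finite_torsion : ∀ n : ℕ, ∃ X : Over S, IsFinite X.hom ∧ Flat X.hom ∧ LocallyOfFinitePresentation X.hom ∧
    Nonempty (((torsion B (p ^ n)).obj ⋙ forget AddCommGrpCat.{u + 1}).RepresentableBy X)

/-- The quotient `L / mL`. -/
abbrev modN (L : FppfAb S) (m : ℕ) : FppfAb S :=
  cokernel (m • 𝟙 L)

/-- The projection `L ⟶ L / mL`. -/
def modNπ (L : FppfAb S) (m : ℕ) : L ⟶ modN L m :=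
  cokernel.π (m • 𝟙 L)

theorem smul_modNπ (L : FppfAb S) (m : ℕ) : m • modNπ L m = 0 := by
  have h : (m • 𝟙 L) ≫ modNπ L m = 0 := cokernel.condition _
  simpa using h

/-- The map `L / p^r L ⟶ L / p^(r+1) L` induced by multiplication by `p` on `L`. -/
def modNStep (L : FppfAb S) (r : ℕ) : modN L (p ^ r) ⟶ modN L (p ^ (r + 1)) :=
  cokernel.desc _ (p • modNπ L (p ^ (r + 1))) (by
    rw [Preadditive.nsmul_comp, Category.id_comp, ← mul_smul, ← pow_succ, smul_modNπ])

theorem modNπ_step (L : FppfAb S) (r : ℕ) :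
    modNπ L (p ^ r) ≫ modNStep p L r = p • modNπ L (p ^ (r + 1)) :=
  cokernel.π_desc _ _ _

/-- The system `L / L ⟶ L / p L ⟶ L / p^2 L ⟶ ⋯` of multiplications by `p`; it is the tensor
product of `L` with the system of the groups `(1 / p^r) ℤ / ℤ` and their inclusions. -/
def modNSystem (L : FppfAb S) : ℕ ⥤ FppfAb S :=
  Functor.ofSequence (X := fun r => modN L (p ^ r)) (modNStep p L)

/-- The group `L[p^∞] = L ⊗ ℚ_p / ℤ_p` attached to a lattice `L`. -/
def latticeBT (L : FppfAb S) : FppfAb S :=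
  colimit (modNSystem p L)

/-! ### The Barsotti-Tate group of a two-term complex `[u : L ⟶ G]` -/

variable {L G : FppfAb S} (u : L ⟶ G)

/-- The cone `L ⟶ G ⊕ L ⟶ G` of multiplication by `m` on `[u : L ⟶ G]`, with the maps
`x ↦ (-u x, -m x)` and `(g, x) ↦ -m g + u x`. -/
abbrev cone (m : ℕ) : ShortComplex (FppfAb S) where
  X₁ := L
  X₂ := G ⊞ L
  X₃ := G
  f := biprod.lift (-u) (-(m • 𝟙 L))
  g := biprod.desc (-(m • 𝟙 G)) u
  zero := by simp

/-- The group `M[m] = H⁻¹(M / mM)` of `M = [u : L ⟶ G]`. -/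
abbrev motiveTorsion (m : ℕ) : FppfAb S :=
  (cone u m).homology

/-- The morphism of cones which is given by the identity of `L`, the map `(g, x) ↦ (g, p x)` of
`G ⊕ L`, and multiplication by `p` on `G`. -/
def coneStep (r : ℕ) : cone u (p ^ r) ⟶ cone u (p ^ (r + 1)) where
  τ₁ := 𝟙 L
  τ₂ := biprod.map (𝟙 G) (p • 𝟙 L)
  τ₃ := p • 𝟙 G
  comm₁₂ := by
    apply biprod.hom_ext <;> simp [cone, pow_succ', mul_smul]
  comm₂₃ := by
    apply biprod.hom_ext' <;> simp [cone, pow_succ', mul_smul]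

/-- The system `M[1] ⟶ M[p] ⟶ M[p^2] ⟶ ⋯`. -/
def motiveSystem : ℕ ⥤ FppfAb S :=
  Functor.ofSequence (X := fun r => motiveTorsion u (p ^ r))
    (fun r => ShortComplex.homologyMap (coneStep p u r))

/-- The Barsotti-Tate group `M[p^∞] = colim_r M[p^r]` of `M = [u : L ⟶ G]`. -/
def motiveBT : FppfAb S :=
  colimit (motiveSystem p u)

/-- The map `G[m] ⟶ M[m]`, `g ↦ (g, 0)`. -/
def torsionToMotive (m : ℕ) : torsion G m ⟶ motiveTorsion u m :=
  (cone u m).liftCycles (torsionι G m ≫ biprod.inl) (by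
    simp [torsionι_smul]) ≫ (cone u m).homologyπ

/-- The map `M[m] ⟶ L / mL`, `(g, x) ↦ x`. -/
def motiveToModN (m : ℕ) : motiveTorsion u m ⟶ modN L m :=
  (cone u m).homologyι ≫ (cone u m).descOpcycles (biprod.snd ≫ modNπ L m) (by
    simp [smul_modNπ])

theorem torsionStep_toMotive (r : ℕ) :
    torsionStep p G r ≫ torsionToMotive u (p ^ (r + 1)) =
      torsionToMotive u (p ^ r) ≫ ShortComplex.homologyMap (coneStep p u r) := by
  rw [torsionToMotive, torsionToMotive, Category.assoc, ShortComplex.homologyπ_naturality,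
    ← Category.assoc, ← Category.assoc]
  congr 1
  rw [← cancel_mono (cone u (p ^ (r + 1))).iCycles]
  simp only [Category.assoc, ShortComplex.cyclesMap_i, ShortComplex.liftCycles_i,
    ShortComplex.liftCycles_i_assoc]
  simp [coneStep, reassoc_of% torsionStep_ι p G r]

theorem motiveStep_toModN (r : ℕ) :
    ShortComplex.homologyMap (coneStep p u r) ≫ motiveToModN u (p ^ (r + 1)) =
      motiveToModN u (p ^ r) ≫ modNStep p L r := by
  rw [motiveToModN, motiveToModN, ShortComplex.homologyι_naturality_assoc, Category.assoc]
  congr 1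
  rw [← cancel_epi (cone u (p ^ r)).pOpcycles]
  simp [coneStep, modNπ_step]

/-- The map `G[p^∞] ⟶ M[p^∞]`. -/
def btι : pTorsion p G ⟶ motiveBT p u :=
  colimMap (NatTrans.ofSequence (F := torsionSystem p G) (G := motiveSystem p u)
    (fun r => torsionToMotive u (p ^ r)) (by
      intro r
      simp only [torsionSystem, motiveSystem, Functor.ofSequence_map_homOfLE_succ]
      exact torsionStep_toMotive p u r))

/-- The map `M[p^∞] ⟶ L[p^∞]`. -/
def btπ : motiveBT p u ⟶ latticeBT p L :=
  colimMap (NatTrans.ofSequence (F := motiveSystem p u) (G := modNSystem p L)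
    (fun r => motiveToModN u (p ^ r)) (by
      intro r
      simp only [modNSystem, motiveSystem, Functor.ofSequence_map_homOfLE_succ]
      exact motiveStep_toModN p u r))

/-- The Barsotti-Tate group of `[u : L ⟶ G]` is isomorphic to `B`, as an extension of `L[p^∞]` by
`G[p^∞]`, where the extension structure of `B` is given by `i` and `q`. -/
def BTIsoAsExtension {B : FppfAb S} (i : pTorsion p G ⟶ B) (q : B ⟶ latticeBT p L) : Prop :=
  ∃ e : motiveBT p u ≅ B, btι p u ≫ e.hom = i ∧ e.hom ≫ q = btπ p u

end

end OneMotive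

end

open OneMotive

/-! Fix `N` with `𝔪 ^ N = 0`. Two facts about tori carry the argument. First, `p ∈ 𝔪`, so each
`p`-th power moves a unit congruent to `1` one step deeper in the `𝔪`-adic filtration; hence `p ^ N`
kills every point of `T` that vanishes modulo `𝔪` (`pow_smul_eq_zero_of_vanishesMod`). Second, the
closed fibre of an étale `R`-algebra is a perfect ring, so on its points, where `T` is split,
multiplication by `p` is bijective (`bijective_pow_smul_torus`).

Together they give canonical lifts: if `τ n` is the unique `p ^ n`-th root of a point of the closed
fibre, then `p ^ N` times any lift of `τ (n + N)` does not depend on the lift. Applied to `u₀`, this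
yields `φ n : L ⟶ T` with `p • φ (n + 1) = φ n` and `φ 0` lifting `u₀` (`exists_family_torus`).

The same device works in the extension `B`. Over a perfect ring of characteristic `p` the section `x
/ p ^ n` of `L[p^∞]` lifts to a `p ^ n`-torsion section of `B`: fppf-local lifts differ by points of
`T[p ^ n]`, which the `n`-fold Frobenius kills, so they glue after a Frobenius twist
(`exists_div_of_perfect`). Lifting from the closed fibre and multiplying by `p ^ N` gives `σ n : L ⟶
B` with `p • σ (n + 1) = σ n` over `x ↦ x / p ^ n` (`exists_family_extension`). As `σ 0` maps to
zero in `L[p^∞]`, it is a homomorphism `τ : L ⟶ T[p^∞]`, killed by `p ^ N`; it measures the failure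
of `B` to be canonically split.

Existence: take `v = φ 0 - τ`. Since `τ` is zero modulo `𝔪`, `v` lifts `u₀`, and `(g, x) ↦ (g - φ n
x) + σ n x` identifies `M[p ^ ∞]` with `B` (`btIsoAsExtension_of_families`). Uniqueness: if `v` has
Barsotti–Tate group `B`, then `v + τ` is divisible by every `p ^ n` in `Hom(L, T)`
(`divisible_of_btIsoAsExtension`). So two solutions differ by some `p ^ N • g`, which is zero modulo
`𝔪`; then `g` is zero modulo `𝔪` by perfectness, and `p ^ N • g = 0`.

Sections are turned into homomorphisms by `IsGenerating.exists_hom_of_unique`: `L` is constant on an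
étale cover, and uniqueness on étale affines supplies the descent datum. -/

noncomputable section

namespace OneMotive

/-! ### Sections of fppf sheaves: separation, gluing, local lifting -/

section Sections

variable {S : Scheme.{u}}

/-- The sections of a sheaf over an `S`-scheme. -/
abbrev Sec (F : FppfAb S) (X : Over S) : Type (u + 1) := F.obj.obj (op X)

/-- Restriction of sections. -/
def res (F : FppfAb S) {X Y : Over S} (g : Y ⟶ X) : Sec F X →+ Sec F Y := (F.obj.map g.op).hom

/-- The map induced on sections by a morphism of sheaves. -/
def ev {F G : FppfAb S} (f : F ⟶ G) (X : Over S) : Sec F X →+ Sec G X := (f.hom.app (op X)).hom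

/-- The fppf topology on the category of `S`-schemes. -/
abbrev topo (S : Scheme.{u}) : GrothendieckTopology (Over S) := Scheme.fppfTopology.{u}.over S

@[simp]
theorem res_id (F : FppfAb S) {X : Over S} (x : Sec F X) : res F (𝟙 X) x = x := by
  simp [res]

theorem res_res (F : FppfAb S) {X Y Z : Over S} (g : Y ⟶ X) (h : Z ⟶ Y) (x : Sec F X) :
    res F h (res F g x) = res F (h ≫ g) x := by
  simp [res]

@[simp]
theorem ev_id (F : FppfAb S) (X : Over S) (x : Sec F X) : ev (𝟙 F) X x = x := rfl

theorem ev_comp {F G H : FppfAb S} (f : F ⟶ G) (g : G ⟶ H) (X : Over S) (x : Sec F X) :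
    ev (f ≫ g) X x = ev g X (ev f X x) := rfl

theorem ev_res {F G : FppfAb S} (f : F ⟶ G) {X Y : Over S} (g : Y ⟶ X) (x : Sec F X) :
    ev f Y (res F g x) = res G g (ev f X x) :=
  ConcreteCategory.congr_hom (f.hom.naturality g.op) x

@[simp]
theorem ev_zero {F G : FppfAb S} (X : Over S) (x : Sec F X) : ev (0 : F ⟶ G) X x = 0 := rfl

/-- Evaluation on sections as a homomorphism in the morphism. -/
def evHom (F G : FppfAb S) (X : Over S) (x : Sec F X) : (F ⟶ G) →+ Sec G X where
  toFun f := ev f X x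
  map_zero' := rfl
  map_add' _ _ := rfl

@[simp]
theorem ev_sub {F G : FppfAb S} (f g : F ⟶ G) (X : Over S) (x : Sec F X) :
    ev (f - g) X x = ev f X x - ev g X x := (evHom F G X x).map_sub f g

@[simp]
theorem ev_nsmul {F G : FppfAb S} (n : ℕ) (f : F ⟶ G) (X : Over S) (x : Sec F X) :
    ev (n • f) X x = n • ev f X x := map_nsmul (evHom F G X x) n f

theorem hom_ext_sec {F G : FppfAb S} {f g : F ⟶ G}
    (h : ∀ (X : Over S) (x : Sec F X), ev f X x = ev g X x) : f = g := by
  apply Sheaf.hom_ext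
  ext X x
  exact h X.unop x

/-- Sections which agree locally are equal. -/
theorem sec_ext (F : FppfAb S) {X : Over S} {s : Sieve X} (hs : s ∈ topo S X) {x y : Sec F X}
    (h : ∀ (Y : Over S) (g : Y ⟶ X), s g → res F g x = res F g y) : x = y := by
  have hF := (Presheaf.isSheaf_iff_isSheaf_forget (topo S) F.obj (forget AddCommGrpCat)).1 F.property
  rw [isSheaf_iff_isSheaf_of_type] at hF
  exact (hF s hs).isSeparatedFor.ext (fun Y g hg => h Y g hg)

/-- A compatible family of sections glues. -/
theorem sec_glue (F : FppfAb S) {X : Over S} {s : Sieve X} (hs : s ∈ topo S X)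
    (y : ∀ (Y : Over S) (g : Y ⟶ X), s g → Sec F Y)
    (hy : ∀ (Y Z : Over S) (g : Y ⟶ X) (hg : s g) (h : Z ⟶ Y),
      res F h (y Y g hg) = y Z (h ≫ g) (s.downward_closed hg h)) :
    ∃ x : Sec F X, ∀ (Y : Over S) (g : Y ⟶ X) (hg : s g), res F g x = y Y g hg := by
  have hF := (Presheaf.isSheaf_iff_isSheaf_forget (topo S) F.obj (forget AddCommGrpCat)).1 F.property
  rw [isSheaf_iff_isSheaf_of_type] at hF
  have h := hF s hs (fun Y g hg => y Y g hg)
    ((Presieve.compatible_iff_sieveCompatible _).2 (fun Y Z g h hg => (hy Y Z g hg h).symm))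
  obtain ⟨x, hx, -⟩ := h
  exact ⟨x, fun Y g hg => hx g hg⟩

theorem mono_of_sec {F G : FppfAb S} (f : F ⟶ G)
    (h : ∀ (X : Over S) (x : Sec F X), ev f X x = 0 → x = 0) : Mono f := by
  rw [Preadditive.mono_iff_cancel_zero]
  intro P g hg
  apply hom_ext_sec
  intro X x
  apply h
  rw [← ev_comp, hg]
  rfl

theorem epi_of_sec {F G : FppfAb S} (f : F ⟶ G)
    (h : ∀ (X : Over S) (y : Sec G X), ∃ s ∈ topo S X, ∀ (Y : Over S) (g : Y ⟶ X), s g →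
      ∃ x : Sec F Y, ev f Y x = res G g y) : Epi f := by
  rw [Preadditive.epi_iff_cancel_zero]
  intro P g hg
  apply hom_ext_sec
  intro X y
  obtain ⟨s, hs, hy⟩ := h X y
  apply sec_ext _ hs
  intro Y k hk
  obtain ⟨x, hx⟩ := hy Y k hk
  rw [← ev_res, ← hx, ← ev_comp, hg]
  simp

theorem ev_injective {F G : FppfAb S} (f : F ⟶ G) [Mono f] (X : Over S) :
    Function.Injective (ev f X) := by
  have h : Mono ((sheafToPresheaf (topo S) AddCommGrpCat.{u + 1}).map f) := inferInstance
  have h' : Mono (((sheafToPresheaf (topo S) AddCommGrpCat.{u + 1}).map f).app (op X)) :=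
    inferInstance
  exact (AddCommGrpCat.mono_iff_injective _).1 h'

theorem exists_local_lift {F G : FppfAb S} (f : F ⟶ G) [Epi f] (X : Over S) (y : Sec G X) :
    ∃ s ∈ topo S X, ∀ (Y : Over S) (g : Y ⟶ X), s g → ∃ x : Sec F Y, ev f Y x = res G g y := by
  have : Sheaf.IsLocallySurjective f := (Sheaf.isLocallySurjective_iff_epi' _ f).2 inferInstance
  exact ⟨_, Presheaf.imageSieve_mem (topo S) f.hom y, fun Y g hg => hg⟩

instance (X : Over S) :
    PreservesLimitsOfSize.{0, 0} ((sheafSections (topo S) AddCommGrpCat.{u + 1}).obj (op X)) :=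
  inferInstanceAs (PreservesLimitsOfSize.{0, 0}
    (sheafToPresheaf (topo S) AddCommGrpCat.{u + 1} ⋙ (evaluation _ _).obj (op X)))

/-- Taking sections is left exact, so a subobject needs no localization here, in contrast to lifting
along an epimorphism. -/
theorem exists_sec_of_exact {F G H : FppfAb S} (f : F ⟶ G) (g : G ⟶ H) (w : f ≫ g = 0) [Mono f]
    (hE : (ShortComplex.mk f g w).Exact) (X : Over S) (y : Sec G X) (hy : ev g X y = 0) :
    ∃ x, ev f X x = y := by
  have : Mono (ShortComplex.mk f g w).f := ‹Mono f›
  have h := hE.map_of_mono_of_preservesKernel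
    ((sheafSections (topo S) AddCommGrpCat.{u + 1}).obj (op X)) inferInstance inferInstance
  rw [ShortComplex.ab_exact_iff] at h
  exact h y hy

end Sections

theorem exact_of_evaluation {J C : Type*} [Category* J] [Category* C] [Abelian C]
    (X : ShortComplex (J ⥤ C)) (h : ∀ j, (X.map ((evaluation J C).obj j)).Exact) : X.Exact := by
  rw [ShortComplex.exact_iff_isZero_homology, Functor.isZero_iff]
  intro j
  have hj := h j
  rw [ShortComplex.exact_iff_isZero_homology] at hj
  exact hj.of_iso (X.mapHomologyIso ((evaluation J C).obj j)).symm

/-! ### The exact sequence `0 → G[m] → M[m] → L/m → 0` -/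

section MotiveExact

variable {S : Scheme.{u}}

theorem epi_pow_smul (G : FppfAb S) (p : ℕ) [Epi (p • 𝟙 G)] (n : ℕ) : Epi ((p ^ n) • 𝟙 G) := by
  induction n with
  | zero => simpa using (inferInstance : Epi (𝟙 G))
  | succ n ih =>
    have h : (p ^ (n + 1)) • 𝟙 G = ((p ^ n) • 𝟙 G) ≫ (p • 𝟙 G) := by
      simp [pow_succ', mul_smul]
    rw [h]
    infer_instance

theorem mono_pow_smul (G : FppfAb S) (p : ℕ) [Mono (p • 𝟙 G)] (n : ℕ) :
    Mono ((p ^ n) • 𝟙 G) := by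
  induction n with
  | zero => simpa using (inferInstance : Mono (𝟙 G))
  | succ n ih =>
    have h : (p ^ (n + 1)) • 𝟙 G = ((p ^ n) • 𝟙 G) ≫ (p • 𝟙 G) := by
      simp [pow_succ', mul_smul]
    rw [h]
    infer_instance

instance (G : FppfAb S) (m : ℕ) : Mono (torsionι G m) := by
  unfold torsionι
  infer_instance

instance (G : FppfAb S) (m : ℕ) : Epi (modNπ G m) := by
  unfold modNπ
  infer_instance

variable {L G : FppfAb S} (v : L ⟶ G) (m : ℕ)

/-- The projection of the cycles `{(g, x) | m g = v x}` to `G`. -/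
def cyc₁ : (cone v m).cycles ⟶ G := (cone v m).iCycles ≫ biprod.fst

/-- The projection of the cycles `{(g, x) | m g = v x}` to `L`. -/
def cyc₂ : (cone v m).cycles ⟶ L := (cone v m).iCycles ≫ biprod.snd

theorem smul_cyc₁ : m • cyc₁ v m = cyc₂ v m ≫ v := by
  have h : (cone v m).iCycles ≫ biprod.desc (-(m • 𝟙 G)) v = 0 := (cone v m).iCycles_g
  rw [biprod.desc_eq] at h
  simp only [Preadditive.comp_neg, Preadditive.comp_nsmul, Category.comp_id,
    Preadditive.comp_add] at h
  rw [neg_add_eq_zero] at h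
  simpa [cyc₁, cyc₂] using h

theorem cycles_hom_ext {A : FppfAb S} {f g : A ⟶ (cone v m).cycles}
    (h₁ : f ≫ cyc₁ v m = g ≫ cyc₁ v m) (h₂ : f ≫ cyc₂ v m = g ≫ cyc₂ v m) : f = g := by
  rw [← cancel_mono (cone v m).iCycles]
  apply biprod.hom_ext
  · simpa [cyc₁] using h₁
  · simpa [cyc₂] using h₂

/-- Construction of cycles. -/
def mkCyc {A : FppfAb S} (g : A ⟶ G) (x : A ⟶ L) (h : m • g = x ≫ v) :
    A ⟶ (cone v m).cycles :=
  (cone v m).liftCycles (biprod.lift g x) (by simp [cone, h])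

@[simp]
theorem mkCyc_cyc₁ {A : FppfAb S} (g : A ⟶ G) (x : A ⟶ L) (h : m • g = x ≫ v) :
    mkCyc v m g x h ≫ cyc₁ v m = g := by
  simp [mkCyc, cyc₁]

@[simp]
theorem mkCyc_cyc₂ {A : FppfAb S} (g : A ⟶ G) (x : A ⟶ L) (h : m • g = x ≫ v) :
    mkCyc v m g x h ≫ cyc₂ v m = x := by
  simp [mkCyc, cyc₂]

@[simp]
theorem mkCyc_cyc₂_assoc {A A' : FppfAb S} (g : A ⟶ G) (x : A ⟶ L) (h : m • g = x ≫ v)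
    (f : L ⟶ A') : mkCyc v m g x h ≫ cyc₂ v m ≫ f = x ≫ f := by
  rw [← Category.assoc, mkCyc_cyc₂]

@[simp]
theorem toCycles_cyc₁ : (cone v m).toCycles ≫ cyc₁ v m = -v := by
  simp [cyc₁, cone]

@[simp]
theorem toCycles_cyc₂ : (cone v m).toCycles ≫ cyc₂ v m = -(m • 𝟙 L) := by
  simp [cyc₂, cone]

@[simp]
theorem toCycles_cyc₂_assoc {A : FppfAb S} (f : L ⟶ A) :
    (cone v m).toCycles ≫ cyc₂ v m ≫ f = (-(m • 𝟙 L)) ≫ f := by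
  rw [← Category.assoc, toCycles_cyc₂]

/-- The inclusion `g ↦ (g, 0)` of `G[m]` into the cycles. -/
def torsionCyc : torsion G m ⟶ (cone v m).cycles :=
  mkCyc v m (torsionι G m) 0 (by simp [torsionι_smul])

theorem torsionToMotive_eq : torsionToMotive v m = torsionCyc v m ≫ (cone v m).homologyπ := by
  unfold torsionToMotive torsionCyc mkCyc
  congr 2
  apply biprod.hom_ext <;> simp

theorem homologyπ_toModN :
    (cone v m).homologyπ ≫ motiveToModN v m = cyc₂ v m ≫ modNπ L m := by
  simp [motiveToModN, cyc₂]

/-- To complete `x` to a cycle `(g, x)`, divide `v x` by `m` in `G`, locally. -/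
instance [Epi (m • 𝟙 G)] : Epi (cyc₂ v m) := by
  rw [epi_iff_surjective_up_to_refinements]
  intro A x
  obtain ⟨A', π, hπ, g, hg⟩ := surjective_up_to_refinements_of_epi (m • 𝟙 G) (x ≫ v)
  exact ⟨A', π, hπ, mkCyc v m g (π ≫ x) (by simpa using hg.symm), by simp⟩

theorem torsionCyc_exact :
    (ShortComplex.mk (torsionCyc v m) (cyc₂ v m) (by simp [torsionCyc])).Exact := by
  rw [ShortComplex.exact_iff_exact_up_to_refinements]
  intro A z hz
  dsimp at z hz
  refine ⟨A, 𝟙 A, inferInstance, kernel.lift _ (z ≫ cyc₁ v m) ?_, ?_⟩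
  · have := z ≫= smul_cyc₁ v m
    rw [reassoc_of% hz] at this
    simpa using this
  · apply cycles_hom_ext
    · simp [torsionCyc, torsionι]
    · simp [torsionCyc, hz]

/-- For a cycle, `m (g, x) = (v x, m x)`, which is minus the boundary of `x`. -/
theorem smul_homologyπ : m • (cone v m).homologyπ = 0 := by
  have h : m • 𝟙 (cone v m).cycles = -(cyc₂ v m ≫ (cone v m).toCycles) := by
    apply cycles_hom_ext
    · simp [smul_cyc₁]
    · simp
  have h' := h =≫ (cone v m).homologyπ
  simpa using h'

theorem cycles_homology_exact :
    (ShortComplex.mk (cone v m).toCycles (cone v m).homologyπ (by simp)).Exact :=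
  ShortComplex.exact_of_g_is_cokernel _ (cone v m).homologyIsCokernel

theorem motive_zero : torsionToMotive v m ≫ motiveToModN v m = 0 := by
  rw [torsionToMotive_eq, Category.assoc, homologyπ_toModN, torsionCyc]
  simp

/-- On the left, a boundary `(-v x, -m x)` with vanishing `L`-coordinate has `x = 0` because `L` has
no `m`-torsion. On the right, surjectivity is the divisibility of `G`. -/
theorem motive_shortExact [Mono (m • 𝟙 L)] [Epi (m • 𝟙 G)] :
    (ShortComplex.mk (torsionToMotive v m) (motiveToModN v m) (motive_zero v m)).ShortExact := by
  have hepi : Epi (motiveToModN v m) := by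
    have : Epi ((cone v m).homologyπ ≫ motiveToModN v m) := by
      rw [homologyπ_toModN]
      infer_instance
    exact epi_of_epi (cone v m).homologyπ _
  have hmono : Mono (torsionToMotive v m) := by
    rw [Preadditive.mono_iff_cancel_zero]
    intro A t ht
    rw [torsionToMotive_eq, ← Category.assoc] at ht
    obtain ⟨A', π, hπ, x, hx⟩ := (cycles_homology_exact v m).exact_up_to_refinements _ ht
    dsimp at x hx
    have h₂ := hx =≫ cyc₂ v m
    simp only [torsionCyc, Category.assoc, mkCyc_cyc₂, toCycles_cyc₂, comp_zero] at h₂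
    rw [Preadditive.comp_neg, zero_eq_neg, ← zero_comp (Y := L), cancel_mono] at h₂
    have h₁ := hx =≫ cyc₁ v m
    simp only [h₂, torsionCyc, Category.assoc, mkCyc_cyc₁, zero_comp] at h₁
    rw [← cancel_epi π, ← cancel_mono (torsionι G m)]
    simpa using h₁
  refine ShortComplex.ShortExact.mk' ?_ hmono hepi
  rw [ShortComplex.exact_iff_exact_up_to_refinements]
  intro A y hy
  dsimp at y hy
  obtain ⟨A₁, π₁, hπ₁, z, hz⟩ :=
    surjective_up_to_refinements_of_epi (cone v m).homologyπ y
  have h : (z ≫ cyc₂ v m) ≫ modNπ L m = 0 := by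
    rw [Category.assoc, ← homologyπ_toModN, ← reassoc_of% hz, hy, comp_zero]
  have hex : (ShortComplex.mk (m • 𝟙 L) (modNπ L m) (cokernel.condition _)).Exact :=
    ShortComplex.exact_cokernel _
  obtain ⟨A₂, π₂, hπ₂, x, hx⟩ := hex.exact_up_to_refinements _ h
  dsimp at x hx
  -- The `L`-coordinate of `z` is `m x`; adding the boundary of `x` removes it without changing the
  -- homology class.
  have h₀ : (π₂ ≫ z + x ≫ (cone v m).toCycles) ≫ cyc₂ v m = 0 := by
    simp only [Preadditive.add_comp, Category.assoc, toCycles_cyc₂]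
    rw [hx]
    simp
  obtain ⟨A₃, π₃, hπ₃, t, ht⟩ := (torsionCyc_exact v m).exact_up_to_refinements _ h₀
  dsimp at t ht
  refine ⟨A₃, π₃ ≫ π₂ ≫ π₁, inferInstance, t, ?_⟩
  dsimp
  rw [torsionToMotive_eq, ← reassoc_of% ht]
  simp [hz]

end MotiveExact

/-! ### Passage to the colimit, and the criterion for `M[p^∞] ≅ B` -/

section MotiveBT

variable {S : Scheme.{u}} (p : ℕ)

theorem hasExactColimits_nat : HasExactColimitsOfShape ℕ AddCommGrpCat.{u + 1} :=
  have : AB5OfSize.{0, 0} AddCommGrpCat.{u + 1} :=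
    AB5OfSize_shrink.{0, 0, u + 1, u + 1} AddCommGrpCat.{u + 1}
  AB5OfSize.ofShape ℕ

instance : HasExactColimitsOfShape ℕ (FppfAb S) :=
  have := hasExactColimits_nat.{u}
  inferInstanceAs (HasExactColimitsOfShape ℕ (Sheaf (topo S) AddCommGrpCat.{u + 1}))

instance : (colim (J := ℕ) (C := FppfAb S)).PreservesMonomorphisms :=
  have := HasExactColimitsOfShape.preservesFiniteLimits (J := ℕ) (C := FppfAb S)
  inferInstance

/-- The inclusion `G[p^r] ⟶ G[p^∞]`. -/
def toPTorsion (G : FppfAb S) (r : ℕ) : torsion G (p ^ r) ⟶ pTorsion p G :=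
  colimit.ι (torsionSystem p G) r

theorem toPTorsion_ι (G : FppfAb S) (r : ℕ) :
    toPTorsion p G r ≫ pTorsionι p G = torsionι G (p ^ r) :=
  colimit.ι_desc _ _

theorem pTorsion_hom_ext {G A : FppfAb S} {f g : pTorsion p G ⟶ A}
    (h : ∀ r, toPTorsion p G r ≫ f = toPTorsion p G r ≫ g) : f = g :=
  colimit.hom_ext h

/-- A sequential colimit of the monomorphisms `G[p^r] ⟶ G` is a monomorphism, by AB5. -/
instance (G : FppfAb S) : Mono (pTorsionι p G) := by
  let φ : torsionSystem p G ⟶ (Functor.const ℕ).obj G :=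
    NatTrans.ofSequence (fun r => torsionι G (p ^ r)) (by
      intro r
      simp only [torsionSystem, Functor.ofSequence_map_homOfLE_succ]
      exact (torsionStep_ι p G r).trans (Category.comp_id _).symm)
  have : ∀ r, Mono (φ.app r) := fun r => inferInstanceAs (Mono (torsionι G (p ^ r)))
  have := NatTrans.mono_of_mono_app φ
  have := IsFiltered.isConnected ℕ
  refine colim.map_mono' φ (colimit.isColimit _) (isColimitConstCocone ℕ G) (pTorsionι p G) ?_
  intro r
  exact (colimit.ι_desc _ _).trans (Category.comp_id _).symm

/-- A `p`-th root of a point killed by `p ^ r` is killed by `p ^ (r + 1)`, so `p : G[p^(r+1)] ⟶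
G[p^r]` is already an epimorphism. -/
instance (G : FppfAb S) [Epi (p • 𝟙 G)] : Epi (p • 𝟙 (pTorsion p G)) := by
  rw [Preadditive.epi_iff_cancel_zero]
  intro A h hh
  apply pTorsion_hom_ext
  intro r
  have w : (p • torsionι G (p ^ (r + 1))) ≫ ((p ^ r) • 𝟙 G) = 0 := by
    rw [Preadditive.comp_nsmul, Category.comp_id, ← mul_smul, ← pow_succ, torsionι_smul]
  let d : torsion G (p ^ (r + 1)) ⟶ torsion G (p ^ r) := kernel.lift _ _ w
  have hd : d ≫ torsionι G (p ^ r) = p • torsionι G (p ^ (r + 1)) := kernel.lift_ι _ _ _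
  have hep : Epi d := by
    rw [epi_iff_surjective_up_to_refinements]
    intro A y
    obtain ⟨A', π, hπ, g, hg⟩ :=
      surjective_up_to_refinements_of_epi (p • 𝟙 G) (y ≫ torsionι G (p ^ r))
    have hg' : π ≫ y ≫ torsionι G (p ^ r) = p • g := by simpa using hg
    refine ⟨A', π, hπ, kernel.lift ((p ^ (r + 1)) • 𝟙 G) g ?_, ?_⟩
    · rw [Preadditive.comp_nsmul, Category.comp_id, pow_succ, mul_smul, ← hg',
        ← Preadditive.comp_nsmul, ← Preadditive.comp_nsmul, torsionι_smul]
      simp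
    · rw [← cancel_mono (torsionι G (p ^ r))]
      rw [Category.assoc, Category.assoc, hd]
      refine hg'.trans ?_
      simp [torsionι]
  rw [← cancel_epi d]
  have key : d ≫ toPTorsion p G r = toPTorsion p G (r + 1) ≫ (p • 𝟙 (pTorsion p G)) := by
    rw [← cancel_mono (pTorsionι p G)]
    simp only [Category.assoc, toPTorsion_ι, Preadditive.comp_nsmul, Preadditive.nsmul_comp,
      Category.id_comp, hd]
  rw [reassoc_of% key, hh, comp_zero, comp_zero, comp_zero]

/-- A homomorphism killed by `p^r` factors through the `p`-power torsion. -/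
def torsLift {A G : FppfAb S} (r : ℕ) (f : A ⟶ G) (h : (p ^ r) • f = 0) : A ⟶ pTorsion p G :=
  kernel.lift ((p ^ r) • 𝟙 G) f (by simpa using h) ≫ toPTorsion p G r

@[simp]
theorem torsLift_ι {A G : FppfAb S} (r : ℕ) (f : A ⟶ G) (h : (p ^ r) • f = 0) :
    torsLift p r f h ≫ pTorsionι p G = f := by
  rw [torsLift, Category.assoc, toPTorsion_ι]
  exact kernel.lift_ι _ _ _

/-- The inclusion of `L / p^r L = L ⊗ p^{-r} ℤ / ℤ` into `L[p^∞]`. -/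
def toLatticeBT (L : FppfAb S) (r : ℕ) : modN L (p ^ r) ⟶ latticeBT p L :=
  colimit.ι (modNSystem p L) r

theorem modNStep_toLatticeBT (L : FppfAb S) (r : ℕ) :
    modNStep p L r ≫ toLatticeBT p L (r + 1) = toLatticeBT p L r := by
  have h := colimit.w (modNSystem p L) (homOfLE (Nat.le_add_right r 1))
  simp only [modNSystem, Functor.ofSequence_map_homOfLE_succ] at h
  exact h

/-- The map `x ↦ x / p^r` from `L` to `L[p^∞] = L ⊗ ℚ_p / ℤ_p`. -/
def divPow (L : FppfAb S) (r : ℕ) : L ⟶ latticeBT p L :=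
  modNπ L (p ^ r) ≫ toLatticeBT p L r

theorem smul_divPow_succ (L : FppfAb S) (r : ℕ) : p • divPow p L (r + 1) = divPow p L r := by
  rw [divPow, ← Preadditive.nsmul_comp, ← modNπ_step, Category.assoc, modNStep_toLatticeBT,
    divPow]

theorem pow_smul_divPow (L : FppfAb S) (r : ℕ) : (p ^ r) • divPow p L r = 0 := by
  rw [divPow, ← Preadditive.nsmul_comp, smul_modNπ, zero_comp]

variable {L G : FppfAb S} (v : L ⟶ G)

/-- The map `M[p^r] ⟶ M[p^∞]`. -/
def toMotiveBT (r : ℕ) : motiveTorsion v (p ^ r) ⟶ motiveBT p v :=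
  colimit.ι (motiveSystem p v) r

theorem motiveBT_hom_ext {A : FppfAb S} {f g : motiveBT p v ⟶ A}
    (h : ∀ r, toMotiveBT p v r ≫ f = toMotiveBT p v r ≫ g) : f = g :=
  colimit.hom_ext h

theorem toPTorsion_btι (r : ℕ) :
    toPTorsion p G r ≫ btι p v = torsionToMotive v (p ^ r) ≫ toMotiveBT p v r :=
  ι_colimMap _ _

theorem toMotiveBT_btπ (r : ℕ) :
    toMotiveBT p v r ≫ btπ p v = motiveToModN v (p ^ r) ≫ toLatticeBT p L r :=
  ι_colimMap _ _

theorem bt_zero : btι p v ≫ btπ p v = 0 := by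
  apply pTorsion_hom_ext
  intro r
  rw [← Category.assoc, toPTorsion_btι, Category.assoc, toMotiveBT_btπ, ← Category.assoc,
    motive_zero, zero_comp, comp_zero]

/-- Colimits along `ℕ` are exact, so the sequences of the finite levels pass to the limit. -/
theorem bt_shortExact [Mono (p • 𝟙 L)] [Epi (p • 𝟙 G)] :
    (ShortComplex.mk (btι p v) (btπ p v) (bt_zero p v)).ShortExact := by
  have hL := mono_pow_smul L p
  have hG := epi_pow_smul G p
  let α : torsionSystem p G ⟶ motiveSystem p v :=
    NatTrans.ofSequence (fun r => torsionToMotive v (p ^ r)) (by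
      intro r
      simp only [torsionSystem, motiveSystem, Functor.ofSequence_map_homOfLE_succ]
      exact torsionStep_toMotive p v r)
  let β : motiveSystem p v ⟶ modNSystem p L :=
    NatTrans.ofSequence (fun r => motiveToModN v (p ^ r)) (by
      intro r
      simp only [modNSystem, motiveSystem, Functor.ofSequence_map_homOfLE_succ]
      exact motiveStep_toModN p v r)
  have hαβ : α ≫ β = 0 := by
    ext r : 2
    exact motive_zero v (p ^ r)
  have hse : ∀ r : ℕ, ((ShortComplex.mk α β hαβ).map ((evaluation ℕ _).obj r)).ShortExact :=
    fun r => motive_shortExact v (p ^ r)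
  have hα : ∀ r, Mono (α.app r) := fun r => (hse r).mono_f
  have hβ : ∀ r, Epi (β.app r) := fun r => (hse r).epi_g
  have := NatTrans.mono_of_mono_app α
  refine ShortComplex.ShortExact.mk' ?_ ?_ ?_
  · exact colim.exact_mapShortComplex
      (exact_of_evaluation (ShortComplex.mk α β hαβ) (fun r => (hse r).exact))
      (colimit.isColimit _) (colimit.isColimit _) (colimit.isColimit _) (btι p v) (btπ p v)
      (fun r => ι_colimMap _ _) (fun r => ι_colimMap _ _)
  · exact colim.map_mono' α (colimit.isColimit _) (colimit.isColimit _) (btι p v)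
      (fun r => ι_colimMap _ _)
  · exact colim.map_epi' β (colimit.cocone _) (colimit.isColimit _) (btπ p v)
      (fun r => ι_colimMap _ _)

theorem homologyπ_btπ (r : ℕ) : (cone v (p ^ r)).homologyπ ≫ toMotiveBT p v r ≫ btπ p v =
    cyc₂ v (p ^ r) ≫ divPow p L r := by
  rw [toMotiveBT_btπ, ← Category.assoc, homologyπ_toModN, Category.assoc, divPow]

variable {p}

theorem pow_smul_family {A F : FppfAb S} {f : ℕ → (A ⟶ F)} (h : ∀ n, p • f (n + 1) = f n)
    (n m : ℕ) : (p ^ n) • f (m + n) = f m := by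
  induction n with
  | zero => simp
  | succ n ih => rw [pow_succ, mul_smul, ← add_assoc, h, ih]

variable {v} {B : FppfAb S} {i : pTorsion p G ⟶ B} {q : B ⟶ latticeBT p L}

/-- A homomorphism `v` which differs from the initial term of a `p`-divisible family of
homomorphisms by the discrepancy of a `p`-divisible lifting of `L[p^∞]` to `B` has `B` as its
Barsotti-Tate group. -/
theorem btIsoAsExtension_of_families [Mono (p • 𝟙 L)] [Epi (p • 𝟙 G)] (w : i ≫ q = 0)
    (hE : (ShortComplex.mk i q w).ShortExact)
    (f : ℕ → (L ⟶ G)) (hf : ∀ n, p • f (n + 1) = f n)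
    (σ : ℕ → (L ⟶ B)) (hσ : ∀ n, p • σ (n + 1) = σ n) (hq : ∀ n, σ n ≫ q = divPow p L n)
    (N : ℕ) (d : L ⟶ G) (hd : (p ^ N) • d = 0) (hd' : torsLift p N d hd ≫ i = σ 0) :
    BTIsoAsExtension p (f 0 - d) i q := by
  set v := f 0 - d with hv
  -- On cycles `p ^ n g = v x` and `p ^ n f n = f 0`, so `p ^ n (g - f n x) = -d x`, and `p ^ N`
  -- kills `d`.
  have ha : ∀ n, (p ^ (N + n)) • (cyc₁ v (p ^ n) - cyc₂ v (p ^ n) ≫ f n) = 0 := by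
    intro n
    have hfn := pow_smul_family hf n 0
    rw [zero_add] at hfn
    rw [pow_add, mul_smul, smul_sub, smul_cyc₁, ← Preadditive.comp_nsmul, hfn,
      ← Preadditive.comp_sub, hv, sub_sub_cancel_left, Preadditive.comp_neg, smul_neg,
      ← Preadditive.comp_nsmul, hd, comp_zero, neg_zero]
  -- The map `(g, x) ↦ (g - f n x) + σ n x`. On the boundary `(-v x, -p ^ n x)` it takes the value
  -- `(f 0 - v) x - σ 0 x = d x - σ 0 x`, which is zero by the choice of `d`.
  let κ : ∀ n, (cone v (p ^ n)).cycles ⟶ B := fun n =>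
    torsLift p (N + n) _ (ha n) ≫ i + cyc₂ v (p ^ n) ≫ σ n
  have hκ : ∀ n, (cone v (p ^ n)).toCycles ≫ κ n = 0 := by
    intro n
    have hfn := pow_smul_family hf n 0
    have hσn := pow_smul_family hσ n 0
    rw [zero_add] at hfn hσn
    have h₁ : (cone v (p ^ n)).toCycles ≫ torsLift p (N + n) _ (ha n) = torsLift p N d hd := by
      rw [← cancel_mono (pTorsionι p G)]
      simp only [Category.assoc, torsLift_ι, Preadditive.comp_sub, toCycles_cyc₁,
        toCycles_cyc₂_assoc, Preadditive.neg_comp, Preadditive.nsmul_comp, Category.id_comp, hfn]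
      rw [hv]
      abel
    simp only [κ, Preadditive.comp_add, toCycles_cyc₂_assoc, Preadditive.neg_comp,
      Preadditive.nsmul_comp, Category.id_comp, hσn]
    rw [reassoc_of% h₁, hd', add_neg_cancel]
  let e : ∀ n, motiveTorsion v (p ^ n) ⟶ B := fun n =>
    (cone v (p ^ n)).descHomology (κ n) (hκ n)
  have he : ∀ n, (cone v (p ^ n)).homologyπ ≫ e n = κ n := fun n =>
    (cone v (p ^ n)).π_descHomology _ _
  -- The transition map is `(g, x) ↦ (g, p x)`, and `f (n + 1) (p x) = f n x`, likewise for `σ`.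
  have hcomp : ∀ n, ShortComplex.homologyMap (coneStep p v n) ≫ e (n + 1) = e n := by
    intro n
    rw [← cancel_epi (cone v (p ^ n)).homologyπ, ShortComplex.homologyπ_naturality_assoc, he, he]
    have h₁ : ShortComplex.cyclesMap (coneStep p v n) ≫ cyc₁ v (p ^ (n + 1)) =
        cyc₁ v (p ^ n) := by
      simp [cyc₁, coneStep]
    have h₂ : ShortComplex.cyclesMap (coneStep p v n) ≫ cyc₂ v (p ^ (n + 1)) =
        p • cyc₂ v (p ^ n) := by
      simp [cyc₂, coneStep]
    have h₃ : ShortComplex.cyclesMap (coneStep p v n) ≫ torsLift p (N + (n + 1)) _ (ha (n + 1)) =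
        torsLift p (N + n) _ (ha n) := by
      rw [← cancel_mono (pTorsionι p G)]
      simp only [Category.assoc, torsLift_ι, Preadditive.comp_sub, h₁, reassoc_of% h₂]
      rw [Preadditive.nsmul_comp, ← Preadditive.comp_nsmul, hf]
    simp only [κ, Preadditive.comp_add, reassoc_of% h₃, reassoc_of% h₂]
    rw [Preadditive.nsmul_comp, ← Preadditive.comp_nsmul, hσ]
  let E : motiveBT p v ⟶ B := colimit.desc (motiveSystem p v)
    ⟨B, NatTrans.ofSequence e (by
      intro r
      simp only [motiveSystem, Functor.ofSequence_map_homOfLE_succ]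
      exact (hcomp r).trans (Category.comp_id _).symm)⟩
  have hEe : ∀ n, toMotiveBT p v n ≫ E = e n := fun n => colimit.ι_desc _ _
  have hi : btι p v ≫ E = i := by
    apply pTorsion_hom_ext
    intro n
    rw [← Category.assoc, toPTorsion_btι, Category.assoc, hEe, torsionToMotive_eq, Category.assoc,
      he]
    have h₁ : torsionCyc v (p ^ n) ≫ torsLift p (N + n) _ (ha n) = toPTorsion p G n := by
      rw [← cancel_mono (pTorsionι p G)]
      simp only [Category.assoc, torsLift_ι, Preadditive.comp_sub, toPTorsion_ι, torsionCyc,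
        mkCyc_cyc₁, mkCyc_cyc₂_assoc, zero_comp, sub_zero]
    simp only [κ, Preadditive.comp_add, reassoc_of% h₁]
    simp [torsionCyc]
  have hπ : E ≫ q = btπ p v := by
    apply motiveBT_hom_ext
    intro n
    rw [← cancel_epi (cone v (p ^ n)).homologyπ, homologyπ_btπ, ← hq, reassoc_of% hEe,
      reassoc_of% he]
    simp [κ, w]
  have hS := bt_shortExact p v
  let φ : ShortComplex.mk (btι p v) (btπ p v) (bt_zero p v) ⟶ ShortComplex.mk i q w :=
    { τ₁ := 𝟙 _
      τ₂ := E
      τ₃ := 𝟙 _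
      comm₁₂ := by simp [hi]
      comm₂₃ := by simp [hπ] }
  have h₁ : IsIso φ.τ₁ := inferInstanceAs (IsIso (𝟙 _))
  have h₃ : IsIso φ.τ₃ := inferInstanceAs (IsIso (𝟙 _))
  have : IsIso E := ShortComplex.isIso₂_of_shortExact_of_isIso₁₃ φ hS hE
  exact ⟨asIso E, hi, hπ⟩

/-- If `B` is the Barsotti-Tate group of `v`, then `v` is divisible by all powers of `p` up to
the discrepancy of a `p`-divisible lifting of `L[p^∞]` to `B`. -/
theorem divisible_of_btIsoAsExtension [Epi (p • 𝟙 G)] (w : i ≫ q = 0)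
    (hE : (ShortComplex.mk i q w).ShortExact)
    (σ : ℕ → (L ⟶ B)) (hσ : ∀ n, p • σ (n + 1) = σ n) (hq : ∀ n, σ n ≫ q = divPow p L n)
    (t : L ⟶ pTorsion p G) (ht : t ≫ i = σ 0) (hv : BTIsoAsExtension p v i q) (n : ℕ) :
    ∃ f : L ⟶ G, (p ^ n) • f = v + t ≫ pTorsionι p G := by
  have hG := epi_pow_smul G p n
  obtain ⟨e, hei, heq⟩ := hv
  have hmono : Mono i := hE.mono_f
  have hσn := pow_smul_family hσ n 0
  rw [zero_add] at hσn
  let ε : (cone v (p ^ n)).cycles ⟶ B := (cone v (p ^ n)).homologyπ ≫ toMotiveBT p v n ≫ e.hom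
  have hε : (p ^ n) • ε = 0 := by
    rw [← Preadditive.nsmul_comp, smul_homologyπ, zero_comp]
  have hβ : (ε - cyc₂ v (p ^ n) ≫ σ n) ≫ q = 0 := by
    simp only [ε, Preadditive.sub_comp, Category.assoc, heq, hq, homologyπ_btπ, sub_self]
  obtain ⟨α, hα⟩ : ∃ α : (cone v (p ^ n)).cycles ⟶ pTorsion p G,
      α ≫ i = ε - cyc₂ v (p ^ n) ≫ σ n :=
    ⟨hE.exact.lift _ hβ, hE.exact.lift_f _ hβ⟩
  -- On `(g, 0)` the isomorphism with `B` is `i`, so `α` is `g` there. Hence `(g, x) ↦ g - α (g, x)`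
  -- depends only on `x`, and this function of `x` is the desired root.
  have hz : torsionCyc v (p ^ n) ≫ (cyc₁ v (p ^ n) - α ≫ pTorsionι p G) = 0 := by
    have h : torsionCyc v (p ^ n) ≫ α = toPTorsion p G n := by
      rw [← cancel_mono i, Category.assoc, hα]
      simp only [ε, Preadditive.comp_sub, ← Category.assoc]
      rw [← torsionToMotive_eq, ← toPTorsion_btι, Category.assoc, hei]
      simp [torsionCyc]
    rw [Preadditive.comp_sub, reassoc_of% h, toPTorsion_ι]
    simp [torsionCyc]
  have hepi : Epi (ShortComplex.mk (torsionCyc v (p ^ n)) (cyc₂ v (p ^ n))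
      (by simp [torsionCyc])).g := inferInstanceAs (Epi (cyc₂ v (p ^ n)))
  obtain ⟨f, hf⟩ : ∃ f : L ⟶ G, cyc₂ v (p ^ n) ≫ f = cyc₁ v (p ^ n) - α ≫ pTorsionι p G :=
    ⟨(torsionCyc_exact v (p ^ n)).desc _ hz, (torsionCyc_exact v (p ^ n)).g_desc _ hz⟩
  refine ⟨f, ?_⟩
  -- `ε` factors through `M[p ^ n]`, so `p ^ n` kills it; what remains of `α` is `-p ^ n σ n x = -σ
  -- 0 x`.
  have hpα : (p ^ n) • α = -(cyc₂ v (p ^ n) ≫ t) := by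
    rw [← cancel_mono i, Preadditive.nsmul_comp, hα, smul_sub, hε, ← Preadditive.comp_nsmul, hσn]
    simp [ht]
  rw [← cancel_epi (cyc₂ v (p ^ n)), Preadditive.comp_nsmul, hf, smul_sub, smul_cyc₁,
    ← Preadditive.nsmul_comp, hpα]
  simp

end MotiveBT

/-! ### Fppf coverings and reduction to affine schemes -/

section Coverings

variable {S : Scheme.{u}}

/-- Sieves which contain a jointly surjective family of flat morphisms locally of finite
presentation are covering. -/
theorem mem_topo_of_family {X : Over S} (s : Sieve X) {ι : Type*} (Y : ι → Scheme.{u})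
    (f : ∀ j, Y j ⟶ X.left) (h₁ : ∀ j, Flat (f j)) (h₂ : ∀ j, LocallyOfFinitePresentation (f j))
    (hf : ∀ x : X.left, ∃ j, x ∈ Set.range (f j))
    (hs : ∀ j, s (Over.homMk (f j) : Over.mk (f j ≫ X.hom) ⟶ X)) : s ∈ topo S X := by
  rw [GrothendieckTopology.mem_over_iff]
  have h : Presieve.ofArrows Y f ∈ Scheme.fppfPrecoverage.{u} X.left := by
    unfold Scheme.fppfPrecoverage
    rw [Scheme.ofArrows_mem_precoverage_iff]
    exact ⟨hf, fun j => ⟨h₁ j, h₂ j⟩⟩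
  refine GrothendieckTopology.superset_covering _ ?_
    (Precoverage.generate_mem_toGrothendieck h)
  rw [Sieve.generate_le_iff]
  rintro _ _ ⟨j⟩
  exact (Sieve.overEquiv_iff _ _).2 (hs j)

theorem mem_topo_of_cover {X Y : Over S} (s : Sieve X) (f : Y ⟶ X) [Flat f.left]
    [LocallyOfFinitePresentation f.left] [Surjective f.left] (hs : s f) : s ∈ topo S X := by
  refine mem_topo_of_family s (fun _ : Unit => Y.left) (fun _ => f.left)
    (fun _ => inferInstance) (fun _ => inferInstance)
    (fun x => ⟨(), f.left.surjective x⟩) (fun _ => ?_)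
  have : (Over.homMk f.left : Over.mk (f.left ≫ X.hom) ⟶ X) =
      (Over.homMk (𝟙 _) : Over.mk (f.left ≫ X.hom) ⟶ Y) ≫ f := by
    ext
    simp
  rw [this]
  exact s.downward_closed hs _

/-- An affine scheme over `S`. -/
abbrev aff {C : CommRingCat.{u}} (g : Spec C ⟶ S) : Over S := Over.mk g

/-- The sieve of the morphisms which factor through an affine open subscheme. -/
def affineSieve (X : Over S) : Sieve X where
  arrows Y g := ∃ (C : CommRingCat.{u}) (j : Spec C ⟶ X.left) (_ : IsOpenImmersion j)
    (h : Y ⟶ aff (j ≫ X.hom)), g = h ≫ Over.homMk j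
  downward_closed := by
    rintro Y Z g ⟨C, j, hj, h, rfl⟩ k
    exact ⟨C, j, hj, k ≫ h, by simp⟩

theorem affineSieve_mem (X : Over S) : affineSieve X ∈ topo S X := by
  refine mem_topo_of_family _ (fun j => Spec (X.left.affineOpenCover.X j)) X.left.affineOpenCover.f
    (fun _ => inferInstance) (fun _ => inferInstance)
    (fun x => ⟨X.left.affineOpenCover.idx x, X.left.affineOpenCover.covers x⟩) (fun j => ?_)
  exact ⟨_, X.left.affineOpenCover.f j, inferInstance, 𝟙 _, by simp⟩

/-- Whether a sieve is covering can be checked after pullback to affine schemes. -/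
theorem mem_topo_of_aff {X : Over S} (s : Sieve X)
    (h : ∀ (C : CommRingCat.{u}) (g : Spec C ⟶ S) (k : aff g ⟶ X), s.pullback k ∈ topo S (aff g)) :
    s ∈ topo S X := by
  refine (topo S).transitive (affineSieve_mem X) s ?_
  rintro Y _ ⟨C, j, hj, k, rfl⟩
  rw [Sieve.pullback_comp]
  exact (topo S).pullback_stable _ (h _ _ _)

/-- Sections which agree on affine schemes are equal. -/
theorem sec_ext_aff (F : FppfAb S) {X : Over S} {s : Sieve X} (hs : s ∈ topo S X) {x y : Sec F X}
    (h : ∀ (C : CommRingCat.{u}) (g : Spec C ⟶ S) (k : aff g ⟶ X), s k →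
      res F k x = res F k y) : x = y := by
  apply sec_ext F hs
  intro Y g hg
  apply sec_ext F (affineSieve_mem Y)
  rintro Z _ ⟨C, j, hj, k, rfl⟩
  rw [← res_res, ← res_res, res_res F g, res_res F g, h _ _ _ (s.downward_closed hg _)]

/-- The sieve of the morphisms from objects which map to `U`. -/
def throughSieve (X U : Over S) : Sieve X where
  arrows Y _ := Nonempty (Y ⟶ U)
  downward_closed := by
    rintro Y Z g ⟨h⟩ k
    exact ⟨k ≫ h⟩

theorem throughSieve_mem (X U : Over S) [Flat U.hom] [LocallyOfFinitePresentation U.hom]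
    [Surjective U.hom] : throughSieve X U ∈ topo S X := by
  let Y : Over S := Over.mk (pullback.fst X.hom U.hom ≫ X.hom)
  let f : Y ⟶ X := Over.homMk (pullback.fst X.hom U.hom)
  have : Flat f.left := inferInstanceAs (Flat (pullback.fst X.hom U.hom))
  have : LocallyOfFinitePresentation f.left :=
    inferInstanceAs (LocallyOfFinitePresentation (pullback.fst X.hom U.hom))
  have : Surjective f.left := inferInstanceAs (Surjective (pullback.fst X.hom U.hom))
  exact mem_topo_of_cover _ f
    ⟨Over.homMk (pullback.snd X.hom U.hom) pullback.condition.symm⟩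

/-- Local sections on affine schemes which are characterized by a property glue. -/
theorem exists_glue_of_unique (F : FppfAb S) (X : Over S)
    (Q : ∀ {C : CommRingCat.{u}} {g : Spec C ⟶ S}, (aff g ⟶ X) → Sec F (aff g) → Prop)
    (hres : ∀ {C D : CommRingCat.{u}} {g : Spec C ⟶ S} {h : Spec D ⟶ S} (k : aff g ⟶ X)
      (l : aff h ⟶ aff g) (y : Sec F (aff g)), Q k y → Q (l ≫ k) (res F l y))
    (huniq : ∀ {C : CommRingCat.{u}} {g : Spec C ⟶ S} (k : aff g ⟶ X) (y y' : Sec F (aff g)),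
      Q k y → Q k y' → y = y')
    {s : Sieve X} (hs : s ∈ topo S X)
    (hex : ∀ {C : CommRingCat.{u}} {g : Spec C ⟶ S} (k : aff g ⟶ X), s k → ∃ y, Q k y) :
    ∃ x : Sec F X, ∀ {C : CommRingCat.{u}} {g : Spec C ⟶ S} (k : aff g ⟶ X) (y : Sec F (aff g)),
      Q k y → res F k x = y := by
  -- `Q` speaks only of affine objects. `t` collects the arrows over which some section satisfies
  -- `Q` on all affine schemes; such a section is unique, so arbitrary choices are compatible and
  -- glue.
  let t : Sieve X :=
    { arrows := fun Y g => ∃ y : Sec F Y, ∀ {C : CommRingCat.{u}} {h : Spec C ⟶ S} (k : aff h ⟶ Y),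
        Q (k ≫ g) (res F k y)
      downward_closed := by
        rintro Y Z g ⟨y, hy⟩ k
        refine ⟨res F k y, fun l => ?_⟩
        rw [res_res, ← Category.assoc]
        exact hy (l ≫ k) }
  have ht : t ∈ topo S X := by
    refine (topo S).transitive hs t ?_
    intro Y g hg
    refine (topo S).superset_covering ?_ (affineSieve_mem Y)
    rintro Z _ ⟨C, j, hj, h, rfl⟩
    have hj : t ((Over.homMk j : aff (j ≫ Y.hom) ⟶ Y) ≫ g) := ?_
    · rw [Sieve.pullback_apply, Category.assoc]
      exact t.downward_closed hj h
    obtain ⟨y, hy⟩ := hex (Over.homMk j ≫ g : aff (j ≫ Y.hom) ⟶ X) (s.downward_closed hg _)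
    exact ⟨y, fun k => hres _ _ _ hy⟩
  obtain ⟨x, hx⟩ := sec_glue F ht (fun Y g hg => hg.choose) (by
    intro Y Z g hg h
    apply sec_ext_aff F ((topo S).top_mem Z)
    intro C l k _
    have h₁ := hg.choose_spec (k ≫ h)
    have h₂ := (t.downward_closed hg h).choose_spec k
    rw [Category.assoc] at h₁
    rw [res_res]
    exact huniq _ _ _ h₁ h₂)
  refine ⟨x, fun {C g} k y hy => ?_⟩
  have hk : t k := ⟨y, fun l => hres _ _ _ hy⟩
  rw [hx _ k hk]
  have h := hk.choose_spec (𝟙 _)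
  rw [res_id, Category.id_comp] at h
  exact huniq _ _ _ h hy

end Coverings

/-! ### Comparison of objects over `S` and over `U` -/

section Lower

variable {S U : Scheme.{u}} {f : U ⟶ S}

/-- An `S`-scheme with an `S`-morphism to `U`, as a `U`-scheme. -/
abbrev lower {X : Over S} (h : X ⟶ Over.mk f) : Over U := Over.mk h.left

/-- A `U`-scheme obtained from an `S`-scheme returns it. -/
def lowerIso {X : Over S} (h : X ⟶ Over.mk f) : (Over.map f).obj (lower h) ≅ X :=
  Over.isoMk (Iso.refl _) (by simpa using (Over.w h).symm)

/-- A morphism of `S`-schemes over `U`, as a morphism of `U`-schemes. -/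
def lowerMap {X Y : Over S} (k : Y ⟶ X) (h : X ⟶ Over.mk f) : lower (k ≫ h) ⟶ lower h :=
  Over.homMk k.left

theorem lowerMap_comp_lowerIso {X Y : Over S} (k : Y ⟶ X) (h : X ⟶ Over.mk f) :
    (Over.map f).map (lowerMap k h) ≫ (lowerIso h).hom = (lowerIso (k ≫ h)).hom ≫ k := by
  ext
  simp [lowerIso, lowerMap]

/-- Sections of the base change over `U`-schemes. -/
def secLower (F : FppfAb S) {X : Over S} (h : X ⟶ Over.mk f) :
    Sec F X ≃+ Sec ((baseChange f).obj F) (lower h) where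
  toFun := res F (lowerIso h).hom
  invFun := res F (lowerIso h).inv
  left_inv x := by rw [res_res]; simp
  right_inv x := by
    have hx := res_res F (lowerIso h).inv (lowerIso h).hom x
    rw [Iso.hom_inv_id] at hx
    exact hx.trans (res_id F _)
  map_add' := map_add _

theorem secLower_res (F : FppfAb S) {X Y : Over S} (k : Y ⟶ X) (h : X ⟶ Over.mk f) (x : Sec F X) :
    secLower F (k ≫ h) (res F k x) = res ((baseChange f).obj F) (lowerMap k h) (secLower F h x) := by
  change res F (lowerIso (k ≫ h)).hom (res F k x) =
    res F ((Over.map f).map (lowerMap k h)) (res F (lowerIso h).hom x)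
  rw [res_res, res_res, lowerMap_comp_lowerIso]

end Lower

/-! ### Coordinates on the points of a split torus -/

section TorusCoordinates

variable {S : Scheme.{u}}

/-- The inclusion of a factor of a power. -/
def powIncl (F : FppfAb S) {d : ℕ} (j : Fin d) : F ⟶ ∏ᶜ fun _ : Fin d => F :=
  Pi.lift (fun j' => if j = j' then 𝟙 F else 0)

theorem sum_powIncl (F : FppfAb S) (d : ℕ) :
    ∑ j : Fin d, Pi.π (fun _ : Fin d => F) j ≫ powIncl F j = 𝟙 _ := by
  apply Pi.hom_ext
  intro j'
  rw [Preadditive.sum_comp, Finset.sum_eq_single j']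
  · simp [powIncl]
  · intro j _ hj
    simp [powIncl, hj]
  · simp

/-- The sections of a power. -/
def secPow (F : FppfAb S) (d : ℕ) (X : Over S) :
    Sec (∏ᶜ fun _ : Fin d => F) X ≃+ (Fin d → Sec F X) where
  toFun x j := ev (Pi.π (fun _ : Fin d => F) j) X x
  invFun y := ∑ j, ev (powIncl F j) X (y j)
  left_inv x := by
    have h := congrArg (evHom _ _ X x) (sum_powIncl F d)
    rw [map_sum] at h
    exact h
  right_inv y := by
    ext j
    beta_reduce
    rw [map_sum, Finset.sum_eq_single j]
    · rw [← ev_comp]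
      simp [powIncl]
    · intro j' _ hj
      rw [← ev_comp]
      simp [powIncl, hj]
    · simp
  map_add' x y := by
    ext j
    simp

/-- The sections of `𝔾_m` over affine schemes. -/
def secGm {C : CommRingCat.{u}} (g : Spec C ⟶ S) : Sec (Gm S) (aff g) ≃+ Additive Cˣ :=
  (AddEquiv.ulift : ULift.{u + 1} (Additive (Γ(Spec C, ⊤))ˣ) ≃+ Additive (Γ(Spec C, ⊤))ˣ).trans
    (MulEquiv.toAdditive (Units.mapEquiv
      (Scheme.ΓSpecIso C).commRingCatIsoToRingEquiv.toMulEquiv))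

theorem secGm_res {C D : CommRingCat.{u}} {g : Spec C ⟶ S} {h : Spec D ⟶ S} (k : aff h ⟶ aff g)
    (φ : C ⟶ D) (hφ : k.left = Spec.map φ) (x : Sec (Gm S) (aff g)) :
    (secGm h (res (Gm S) k x)).toMul = Units.map (φ.hom : C →* D) (secGm g x).toMul := by
  apply Units.ext
  have h := Scheme.ΓSpecIso_naturality φ
  rw [← hφ] at h
  exact RingHom.congr_fun (congrArg CommRingCat.Hom.hom h) ((AddEquiv.ulift :
    ULift.{u + 1} (Additive (Γ(Spec C, ⊤))ˣ) ≃+ _) x).toMul.val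

variable {T : FppfAb S} {U : Scheme.{u}} {f : U ⟶ S} {d : ℕ}

/-- An isomorphism of sheaves induces isomorphisms on sections. -/
def evEquiv {F G : FppfAb S} (e : F ≅ G) (X : Over S) : Sec F X ≃+ Sec G X where
  toFun := ev e.hom X
  invFun := ev e.inv X
  left_inv x := by rw [← ev_comp]; simp
  right_inv x := by rw [← ev_comp]; simp
  map_add' := map_add _

/-- The sections of a split torus over affine schemes. -/
def secTorus (e : (baseChange f).obj T ≅ splitTorus U d) {C : CommRingCat.{u}} {g : Spec C ⟶ S}
    (h : aff g ⟶ Over.mk f) : Sec T (aff g) ≃+ (Fin d → Additive Cˣ) :=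
  (secLower T h).trans <|
    (evEquiv e (lower h)).trans <|
    (secPow (Gm U) d (lower h)).trans <|
    AddEquiv.piCongrRight fun _ => secGm h.left

theorem secTorus_res (e : (baseChange f).obj T ≅ splitTorus U d) {C D : CommRingCat.{u}}
    {g : Spec C ⟶ S} {g' : Spec D ⟶ S} (k : aff g' ⟶ aff g) (h : aff g ⟶ Over.mk f)
    (φ : C ⟶ D) (hφ : k.left = Spec.map φ) (x : Sec T (aff g)) (j : Fin d) :
    (secTorus e (k ≫ h) (res T k x) j).toMul =
      Units.map (φ.hom : C →* D) (secTorus e h x j).toMul := by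
  change (secGm (k ≫ h).left (ev (Pi.π (fun _ : Fin d => Gm U) j) (lower (k ≫ h))
      (ev e.hom (lower (k ≫ h)) (secLower T (k ≫ h) (res T k x))))).toMul =
    Units.map _ (secGm h.left (ev (Pi.π (fun _ : Fin d => Gm U) j) (lower h)
      (ev e.hom (lower h) (secLower T h x)))).toMul
  rw [secLower_res, ev_res]
  refine (congrArg (fun z => (secGm (k ≫ h).left z).toMul)
    (ev_res (Pi.π (fun _ : Fin d => Gm U) j) (lowerMap k h)
      (ev e.hom (lower h) (secLower T h x)))).trans ?_
  exact secGm_res (g := h.left) (h := (k ≫ h).left) (lowerMap k h) φ hφ _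

end TorusCoordinates

/-! ### Powers of units, perfect rings and extraction of roots -/

section Algebra

open IsLocalRing

/-- In `a ^ p - 1 = (a - 1)(1 + a + ⋯ + a ^ (p - 1))` the second factor is congruent to `p`, hence
to `0`, modulo `I`. -/
theorem pow_sub_one_mem {A : Type*} [CommRing A] {I : Ideal A} {p : ℕ} (hp : (p : A) ∈ I) {a : A}
    {k : ℕ} (ha : a - 1 ∈ I ^ (k + 1)) : a ^ p - 1 ∈ I ^ (k + 2) := by
  have hI : a - 1 ∈ I := Ideal.pow_le_self (Nat.succ_ne_zero k) ha
  have h : ∑ i ∈ Finset.range p, a ^ i ∈ I := by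
    rw [← Ideal.Quotient.eq_zero_iff_mem] at hp hI ⊢
    rw [map_sub, map_one, sub_eq_zero] at hI
    rw [map_sum]
    simpa [hI] using hp
  rw [← mul_geom_sum, pow_succ]
  exact Ideal.mul_mem_mul ha h

/-- Every `p`-th power gains one power of `I`. This is why `p ^ N` kills the kernel of reduction of
a torus. -/
theorem pow_pow_eq_one {A : Type*} [CommRing A] {I : Ideal A} {p N : ℕ} (hp : (p : A) ∈ I)
    (hN : I ^ N = ⊥) {a : A} (ha : a - 1 ∈ I) : a ^ p ^ N = 1 := by
  have h : ∀ k, a ^ p ^ k - 1 ∈ I ^ (k + 1) := by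
    intro k
    induction k with
    | zero => simpa using ha
    | succ k ih =>
      rw [pow_succ p, pow_mul]
      exact pow_sub_one_mem hp ih
  have h' := Ideal.pow_le_pow_right (Nat.le_succ N) (h N)
  rw [hN, Ideal.mem_bot, sub_eq_zero] at h'
  exact h'

theorem exists_unit_lift {A : Type*} [CommRing A] {I : Ideal A} {N : ℕ} (hN : I ^ N = ⊥)
    (a : (A ⧸ I)ˣ) : ∃ b : Aˣ, Units.map (Ideal.Quotient.mk I : A →* A ⧸ I) b = a := by
  obtain ⟨b, hb⟩ := Ideal.Quotient.mk_surjective (a : A ⧸ I)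
  have h : IsUnit b := by
    rw [← IsNilpotent.isUnit_quotient_mk_iff (I := I) ⟨N, hN⟩, hb]
    exact a.isUnit
  exact ⟨h.unit, Units.ext hb⟩

/-- An étale algebra over a perfect field is a perfect ring. -/
theorem perfectRing_of_etale (k A : Type u) [Field k] [PerfectField k] [CommRing A] [Algebra k A]
    [Algebra.Etale k A] (p : ℕ) [Fact p.Prime] [CharP k p] : PerfectRing A p := by
  obtain ⟨I, _, Ai, _, _, e, h⟩ := (Algebra.Etale.iff_exists_algEquiv_prod (K := k) (A := A)).1
    inferInstance
  have hAi : ∀ i, Function.Bijective (fun x : Ai i => x ^ p) := by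
    intro i
    have := (h i).1
    have := Algebra.IsAlgebraic.perfectField k (L := Ai i)
    have := charP_of_injective_algebraMap (algebraMap k (Ai i)).injective p
    have : ExpChar (Ai i) p := ExpChar.prime Fact.out
    exact PerfectRing.bijective_frobenius
  refine ⟨⟨fun x y hxy => ?_, fun y => ?_⟩⟩
  · apply e.injective
    ext i
    apply (hAi i).1
    have := congrFun (congrArg e hxy) i
    simpa using this
  · choose z hz using fun i => (hAi i).2 (e y i)
    refine ⟨e.symm z, e.injective ?_⟩
    ext i
    simpa using hz i

/-- `A / 𝔪A` is the base change of `A` to the residue field, an étale algebra over a perfect field.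
This is where perfectness of the residue field enters. -/
theorem perfectRing_quotient_of_etale (R A : Type u) [CommRing R] [IsLocalRing R] [CommRing A]
    [Algebra R A] [Algebra.Etale R A] (p : ℕ) [Fact p.Prime] [CharP (ResidueField R) p]
    [PerfectField (ResidueField R)] :
    PerfectRing (A ⧸ (maximalIdeal R).map (algebraMap R A)) p := by
  have h := perfectRing_of_etale (ResidueField R) (TensorProduct R (ResidueField R) A) p
  let e₁ := Algebra.TensorProduct.quotIdealMapEquivTensorQuot A (maximalIdeal R)
  let e₂ := Algebra.TensorProduct.comm R A (R ⧸ maximalIdeal R)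
  let e : (A ⧸ (maximalIdeal R).map (algebraMap R A)) ≃+* TensorProduct R (ResidueField R) A :=
    e₁.toRingEquiv.trans e₂.toRingEquiv
  have h' := h.bijective_frobenius
  refine ⟨⟨fun x y hxy => ?_, fun y => ?_⟩⟩
  · apply e.injective
    apply h'.1
    have := congrArg e hxy
    simpa using this
  · obtain ⟨z, hz⟩ := h'.2 (e y)
    refine ⟨e.symm z, e.injective ?_⟩
    simpa using hz

theorem bijective_units_pow {A : Type*} [CommRing A] {p : ℕ} [PerfectRing A p] (n : ℕ)
    (hp : p ≠ 0) : Function.Bijective (fun x : Aˣ => x ^ p ^ n) := by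
  have h : Function.Bijective fun x : A => x ^ p ^ n :=
    (PerfectRing.pow A p n).bijective_frobenius
  refine ⟨fun x y hxy => Units.ext (h.1 ?_), fun y => ?_⟩
  · simpa using congrArg Units.val hxy
  · obtain ⟨x, hx⟩ := h.2 y
    have hx' : IsUnit x := by
      rw [← isUnit_pow_iff (pow_ne_zero n hp)]
      exact (show x ^ p ^ n = y from hx) ▸ y.isUnit
    exact ⟨hx'.unit, Units.ext hx⟩

/-- The extraction of a `p`-th root of a unit is a faithfully flat extension. -/
theorem exists_root_extension (A : Type u) [CommRing A] (p : ℕ) (hp : p ≠ 0) (a : Aˣ) :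
    ∃ (B : Type u) (_ : CommRing B) (_ : Algebra A B), Module.Free A B ∧
      Algebra.FinitePresentation A B ∧ Module.FaithfullyFlat A B ∧
      ∃ b : Bˣ, b ^ p = Units.map (algebraMap A B : A →* B) a := by
  rcases subsingleton_or_nontrivial A with hA | hA
  · exact ⟨A, inferInstance, Algebra.id A, inferInstance, inferInstance, inferInstance, 1,
      Subsingleton.elim _ _⟩
  let f : Polynomial A := Polynomial.X ^ p - Polynomial.C (a : A)
  have hf : f.Monic := Polynomial.monic_X_pow_sub_C _ hp
  have hdeg : f.natDegree = p := Polynomial.natDegree_X_pow_sub_C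
  have hfree : Module.Free A (AdjoinRoot f) := hf.free_adjoinRoot
  have hfin : Module.Finite A (AdjoinRoot f) := hf.finite_adjoinRoot
  -- Faithful flatness of a free module needs it to be nonzero: `X ^ p - a` is monic of degree `p ≠
  -- 0`, so it is not a unit.
  have hnt : Nontrivial (AdjoinRoot f) := by
    refine Ideal.Quotient.nontrivial_iff.2 ?_
    rw [Ne, Ideal.span_singleton_eq_top]
    intro h
    rw [hf.isUnit_iff] at h
    rw [h, Polynomial.natDegree_one] at hdeg
    exact hp hdeg.symm
  refine ⟨AdjoinRoot f, inferInstance, inferInstance, hfree, ?_, ?_, ?_⟩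
  · exact inferInstance
  · exact inferInstance
  · have hroot : (AdjoinRoot.root f) ^ p = algebraMap A (AdjoinRoot f) a := by
      have := AdjoinRoot.eval₂_root f
      simpa [f, sub_eq_zero] using this
    have hu : IsUnit (AdjoinRoot.root f) := by
      rw [← isUnit_pow_iff hp, hroot]
      exact a.isUnit.map _
    exact ⟨hu.unit, Units.ext hroot⟩

end Algebra

/-! ### The closed fibre, and sections vanishing modulo `𝔪` -/

section Reduction

open IsLocalRing

variable {R : Type u} [CommRing R] [IsLocalRing R]

variable (R) in
/-- The inclusion of the closed point of a local scheme. -/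
abbrev closedPt : Spec (CommRingCat.of (ResidueField R)) ⟶ Spec (CommRingCat.of R) :=
  Spec.map (CommRingCat.ofHom (residue R))

instance : Mono (closedPt R) := by
  have : IsClosedImmersion (closedPt R) :=
    IsClosedImmersion.spec_of_surjective _ (by exact residue_surjective)
  infer_instance

variable {C : CommRingCat.{u}} (g : Spec C ⟶ Spec (CommRingCat.of R))

/-- The extension of the maximal ideal to an algebra. -/
def redIdeal : Ideal C := (maximalIdeal R).map (Spec.preimage g).hom

/-- The reduction of an algebra modulo the maximal ideal. -/
abbrev redRing : CommRingCat.{u} := CommRingCat.of (C ⧸ redIdeal g)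

/-- The closed fibre of an affine scheme. -/
def redk : Spec (redRing g) ⟶ Spec (CommRingCat.of (ResidueField R)) :=
  Spec.map (CommRingCat.ofHom (Ideal.quotientMap (I := maximalIdeal R) (redIdeal g)
    (Spec.preimage g).hom Ideal.le_comap_map))

theorem redk_comp : redk g ≫ closedPt R =
    Spec.map (CommRingCat.ofHom (Ideal.Quotient.mk (redIdeal g))) ≫ g := by
  refine Eq.trans ?_ (congrArg (Spec.map (CommRingCat.ofHom (Ideal.Quotient.mk (redIdeal g))) ≫ ·)
    (Spec.map_preimage g))
  rw [redk, ← Spec.map_comp, ← Spec.map_comp]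
  rfl

/-- The inclusion of the closed fibre of an affine scheme. -/
def redIncl : aff (redk g ≫ closedPt R) ⟶ aff g :=
  Over.homMk (Spec.map (CommRingCat.ofHom (Ideal.Quotient.mk (redIdeal g)))) (redk_comp g).symm

variable {g}

/-- The universal property of the closed fibre: `𝔪` dies in an algebra over the residue field, so a
map to it from `C` factors through `C / 𝔪C`. -/
theorem exists_red_factor {D : CommRingCat.{u}} (z : Spec D ⟶ Spec (CommRingCat.of (ResidueField R)))
    (a : aff (z ≫ closedPt R) ⟶ aff g) :
    ∃ b : aff z ⟶ aff (redk g), (Over.map (closedPt R)).map b ≫ redIncl g = a := by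
  let α := Spec.preimage a.left
  have hα : Spec.map α = a.left := Spec.map_preimage _
  have hw : Spec.map α ≫ g = z ≫ closedPt R := by
    rw [hα]
    exact Over.w a
  have hw' : Spec.preimage g ≫ α = CommRingCat.ofHom (residue R) ≫ Spec.preimage z := by
    apply Spec.map_injective
    rw [Spec.map_comp, Spec.map_comp, Spec.map_preimage g, Spec.map_preimage z, hw]
  have hI : ∀ x ∈ redIdeal g, α.hom x = 0 := by
    have h : redIdeal g ≤ RingHom.ker α.hom := by
      rw [redIdeal, Ideal.map_le_iff_le_comap]
      intro x hx
      rw [Ideal.mem_comap, RingHom.mem_ker]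
      have h := RingHom.congr_fun (congrArg CommRingCat.Hom.hom hw') x
      have hx' : residue R x = 0 := (residue_eq_zero_iff x).2 hx
      simp only [CommRingCat.hom_comp, RingHom.comp_apply, CommRingCat.hom_ofHom, hx',
        map_zero] at h
      exact h
    exact h
  let β : redRing g ⟶ D := CommRingCat.ofHom (Ideal.Quotient.lift (redIdeal g) α.hom hI)
  have hβ : CommRingCat.ofHom (Ideal.Quotient.mk (redIdeal g)) ≫ β = α := by
    ext x
    rfl
  have hβ' : Spec.map β ≫ Spec.map (CommRingCat.ofHom (Ideal.Quotient.mk (redIdeal g))) =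
      a.left := by
    rw [← Spec.map_comp, hβ, hα]
  refine ⟨Over.homMk (Spec.map β) ?_, ?_⟩
  · rw [← cancel_mono (closedPt R)]
    change (Spec.map β ≫ redk g) ≫ closedPt R = z ≫ closedPt R
    rw [Category.assoc, redk_comp, reassoc_of% hβ']
    exact Over.w a
  · ext : 1
    exact hβ'

theorem redIdeal_pow {N : ℕ} (hN : maximalIdeal R ^ N = ⊥) : redIdeal g ^ N = ⊥ := by
  rw [redIdeal, ← Ideal.map_pow, hN, Ideal.map_bot]

theorem natCast_mem_redIdeal (p : ℕ) [CharP (ResidueField R) p] : (p : C) ∈ redIdeal g := by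
  have h : (p : R) ∈ maximalIdeal R := by
    rw [← residue_eq_zero_iff, map_natCast]
    exact CharP.cast_eq_zero _ p
  have := Ideal.mem_map_of_mem (Spec.preimage g).hom h
  rwa [map_natCast] at this

/-- A section vanishes modulo the maximal ideal if it vanishes over all affine schemes on which the
maximal ideal is zero. -/
def VanishesMod {F : FppfAb (Spec (CommRingCat.of R))} {X : Over (Spec (CommRingCat.of R))}
    (x : Sec F X) : Prop :=
  ∀ {D : CommRingCat.{u}} (z : Spec D ⟶ Spec (CommRingCat.of (ResidueField R)))
    (a : aff (z ≫ closedPt R) ⟶ X), res F a x = 0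

theorem vanishesMod_iff {F : FppfAb (Spec (CommRingCat.of R))} (x : Sec F (aff g)) :
    VanishesMod x ↔ res F (redIncl g) x = 0 := by
  refine ⟨fun h => h _ _, fun h D z a => ?_⟩
  obtain ⟨b, rfl⟩ := exists_red_factor z a
  have := congrArg (res F ((Over.map (closedPt R)).map b)) h
  rw [map_zero] at this
  rw [← this]
  exact (res_res F (redIncl g) ((Over.map (closedPt R)).map b) x).symm

theorem VanishesMod.res {F : FppfAb (Spec (CommRingCat.of R))}
    {X Y : Over (Spec (CommRingCat.of R))} {x : Sec F X} (h : VanishesMod x) (k : Y ⟶ X) :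
    VanishesMod (res F k x) := by
  intro D z a
  rw [res_res]
  exact h z _

theorem VanishesMod.ev {F G : FppfAb (Spec (CommRingCat.of R))} (f : F ⟶ G)
    {X : Over (Spec (CommRingCat.of R))} {x : Sec F X} (h : VanishesMod x) :
    VanishesMod (ev f X x) := by
  intro D z a
  rw [← ev_res, h z a, map_zero]

end Reduction

/-! ### Points of a torus: divisibility, Frobenius, kernel of reduction -/

section Torus

open IsLocalRing

variable {S : Scheme.{u}} {T : FppfAb S} {U : Scheme.{u}} {f : U ⟶ S} {d : ℕ}

theorem secTorus_nsmul (e : (baseChange f).obj T ≅ splitTorus U d) {C : CommRingCat.{u}}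
    {g : Spec C ⟶ S} (h : aff g ⟶ Over.mk f) (n : ℕ) (x : Sec T (aff g)) (j : Fin d) :
    (secTorus e h (n • x) j).toMul = (secTorus e h x j).toMul ^ n := by
  rw [map_nsmul]
  rfl

theorem secTorus_eq_zero (e : (baseChange f).obj T ≅ splitTorus U d) {C : CommRingCat.{u}}
    {g : Spec C ⟶ S} (h : aff g ⟶ Over.mk f) (x : Sec T (aff g))
    (hx : ∀ j, (secTorus e h x j).toMul = 1) : x = 0 := by
  apply (secTorus e h).injective
  rw [map_zero]
  ext j
  exact congrArg Units.val (hx j)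

/-- The `p^n`-th power map is bijective on the points of a torus over a perfect ring. -/
theorem bijective_pow_smul_torus (e : (baseChange f).obj T ≅ splitTorus U d) {C : CommRingCat.{u}}
    {g : Spec C ⟶ S} (h : aff g ⟶ Over.mk f) {p : ℕ} (hp : p ≠ 0) [PerfectRing C p] (n : ℕ) :
    Function.Bijective (fun x : Sec T (aff g) => p ^ n • x) := by
  have hb := bijective_units_pow (A := C) n hp
  refine ⟨fun x y hxy => ?_, fun y => ?_⟩
  · apply (secTorus e h).injective
    ext j
    refine congrArg Units.val (hb.1 ?_ : (secTorus e h x j).toMul = (secTorus e h y j).toMul)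
    beta_reduce
    rw [← secTorus_nsmul, ← secTorus_nsmul]
    exact congrArg (fun z => (secTorus e h z j).toMul) hxy
  · choose z hz using fun j => hb.2 (secTorus e h y j).toMul
    refine ⟨(secTorus e h).symm (fun j => Additive.ofMul (z j)), (secTorus e h).injective ?_⟩
    ext j
    have := secTorus_nsmul e h (p ^ n) ((secTorus e h).symm (fun j => Additive.ofMul (z j))) j
    rw [AddEquiv.apply_symm_apply] at this
    exact congrArg Units.val (this.trans (hz j))

/-- The iterated Frobenius kills the `p^n`-torsion of a split torus. -/
theorem res_frobenius_eq_zero (e : (baseChange f).obj T ≅ splitTorus U d)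
    {C : CommRingCat.{u}} {g g' : Spec C ⟶ S} (k : aff g' ⟶ aff g) (h : aff g ⟶ Over.mk f) {p n : ℕ}
    (φ : C ⟶ C) (hφ : k.left = Spec.map φ) (hφ' : ∀ x, φ.hom x = x ^ p ^ n) (x : Sec T (aff g))
    (hx : p ^ n • x = 0) : res T k x = 0 := by
  apply secTorus_eq_zero e (k ≫ h)
  intro j
  rw [secTorus_res e k h φ hφ]
  have h₁ := secTorus_nsmul e h (p ^ n) x j
  rw [hx, map_zero] at h₁
  apply Units.ext
  have h₂ := congrArg Units.val h₁
  simp only [Units.val_pow_eq_pow_val] at h₂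
  exact (hφ' _).trans h₂.symm

/-- Multiplication by `p` is an epimorphism on a torus. -/
theorem epi_smul_torus (e : (baseChange f).obj T ≅ splitTorus U d) [Flat f]
    [LocallyOfFinitePresentation f] [Surjective f] {p : ℕ} (hp : p ≠ 0) : Epi (p • 𝟙 T) := by
  apply epi_of_sec
  intro X y
  let s : Sieve X :=
    { arrows := fun Y k => ∃ x : Sec T Y, ev (p • 𝟙 T) Y x = res T k y
      downward_closed := by
        rintro Y Z k ⟨x, hx⟩ l
        exact ⟨res T l x, by rw [ev_res, hx, res_res]⟩ }
  refine ⟨s, ?_, fun Y k hk => hk⟩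
  have hthr : throughSieve X (Over.mk f) ∈ topo S X := by
    have : Flat (Over.mk f).hom := ‹Flat f›
    have : LocallyOfFinitePresentation (Over.mk f).hom := ‹LocallyOfFinitePresentation f›
    have : Surjective (Over.mk f).hom := ‹Surjective f›
    exact throughSieve_mem X (Over.mk f)
  refine (topo S).transitive hthr s ?_
  rintro Y k ⟨h⟩
  apply mem_topo_of_aff
  intro C g l
  rw [← Sieve.pullback_comp]
  set y' := res T (l ≫ k) y with hy'
  -- `t j` is the locus where the `j`-th coordinate of `y'` has a `p`-th root. It is covering
  -- because adjoining the root is faithfully flat and finitely presented, and finitely many such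
  -- sieves can be intersected.
  let t : Fin d → Sieve (aff g) := fun j =>
    { arrows := fun Z m => ∀ {D : CommRingCat.{u}} {g' : Spec D ⟶ S} (m' : aff g' ⟶ Z),
        ∃ b : Dˣ, b ^ p = (secTorus e ((m' ≫ m) ≫ l ≫ h) (res T (m' ≫ m) y') j).toMul
      downward_closed := by
        intro Z Z' m hm m' D g' m''
        obtain ⟨b, hb⟩ := hm (m'' ≫ m')
        refine ⟨b, ?_⟩
        rw [hb]
        simp only [Category.assoc] }
  have ht : ∀ j, t j ∈ topo S (aff g) := by
    intro j
    obtain ⟨B, _, _, _, hfp, hff, b, hb⟩ := exists_root_extension C p hp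
      (secTorus e (l ≫ h) y' j).toMul
    let φ : C ⟶ CommRingCat.of B := CommRingCat.ofHom (algebraMap C B)
    let m : aff (Spec.map φ ≫ g) ⟶ aff g := Over.homMk (Spec.map φ)
    have : Flat m.left := by
      change Flat (Spec.map φ)
      rw [HasRingHomProperty.Spec_iff (P := @Flat)]
      exact (RingHom.flat_algebraMap_iff).2 inferInstance
    have : LocallyOfFinitePresentation m.left := by
      change LocallyOfFinitePresentation (Spec.map φ)
      rw [HasRingHomProperty.Spec_iff (P := @LocallyOfFinitePresentation)]
      exact (RingHom.finitePresentation_algebraMap).2 inferInstance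
    have : Surjective m.left := by
      change Surjective (Spec.map φ)
      refine ⟨?_⟩
      exact PrimeSpectrum.comap_surjective_of_faithfullyFlat (A := C) (B := B)
    refine mem_topo_of_cover _ m ?_
    intro D g' m'
    refine ⟨Units.map (Spec.preimage m'.left).hom b, ?_⟩
    rw [← map_pow, hb]
    have h₁ := secTorus_res e m (l ≫ h) φ rfl y' j
    have h₂ := secTorus_res e m' (m ≫ l ≫ h) (Spec.preimage m'.left)
      (Spec.map_preimage _).symm (res T m y') j
    rw [res_res, h₁, ← Category.assoc] at h₂
    exact h₂.symm
  have hall : ∀ J : Finset (Fin d), ∃ s' ∈ topo S (aff g), ∀ j ∈ J, s' ≤ t j := by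
    intro J
    induction J using Finset.induction with
    | empty => exact ⟨⊤, (topo S).top_mem _, by simp⟩
    | insert j J _ ih =>
      obtain ⟨s', hs', hs''⟩ := ih
      refine ⟨s' ⊓ t j, (topo S).intersection_covering hs' (ht j), ?_⟩
      intro j' hj'
      rcases Finset.mem_insert.1 hj' with rfl | hj'
      · exact inf_le_right
      · exact inf_le_left.trans (hs'' j' hj')
  obtain ⟨s', hs', hs''⟩ := hall Finset.univ
  refine (topo S).transitive hs' _ ?_
  intro Z m hm
  refine (topo S).superset_covering ?_ (affineSieve_mem Z)
  rintro Z' _ ⟨D, i, hi, m', rfl⟩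
  have hfin : s ((Over.homMk i : aff (i ≫ Z.hom) ⟶ Z) ≫ m ≫ l ≫ k) := by
    let n : aff (i ≫ Z.hom) ⟶ Z := Over.homMk i
    choose b hb using fun j => hs'' j (Finset.mem_univ j) m hm n
    let x := (secTorus e ((n ≫ m) ≫ l ≫ h)).symm (fun j => Additive.ofMul (b j))
    refine ⟨x, ?_⟩
    rw [ev_nsmul, ev_id, ← Category.assoc, ← res_res T (l ≫ k)]
    apply (secTorus e ((n ≫ m) ≫ l ≫ h)).injective
    ext j
    have h₁ := secTorus_nsmul e ((n ≫ m) ≫ l ≫ h) p x j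
    rw [AddEquiv.apply_symm_apply] at h₁
    exact congrArg Units.val (h₁.trans (hb j))
  have := s.downward_closed hfin m'
  simpa only [Sieve.pullback_apply, Category.assoc] using this

variable {R : Type u} [CommRing R] [IsLocalRing R]
  {T : FppfAb (Spec (CommRingCat.of R))} {f : U ⟶ Spec (CommRingCat.of R)}

/-- Points of a split torus modulo the maximal ideal lift. -/
theorem exists_lift_torus (e : (baseChange f).obj T ≅ splitTorus U d) {C : CommRingCat.{u}}
    {g : Spec C ⟶ Spec (CommRingCat.of R)} (h : aff g ⟶ Over.mk f) {N : ℕ}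
    (hN : maximalIdeal R ^ N = ⊥) (x : Sec T (aff (redk g ≫ closedPt R))) :
    ∃ y : Sec T (aff g), res T (redIncl g) y = x := by
  choose b hb using fun j => exists_unit_lift (redIdeal_pow (g := g) hN)
    (secTorus e (redIncl g ≫ h) x j).toMul
  refine ⟨(secTorus e h).symm (fun j => Additive.ofMul (b j)),
    (secTorus e (redIncl g ≫ h)).injective ?_⟩
  ext j
  have h₁ := secTorus_res e (redIncl g) h _ rfl ((secTorus e h).symm fun j => Additive.ofMul (b j)) j
  rw [AddEquiv.apply_symm_apply] at h₁
  exact congrArg Units.val (h₁.trans (hb j))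

/-- The kernel of the reduction of a torus is killed by a power of `p`. -/
theorem pow_smul_eq_zero_of_vanishesMod (e : (baseChange f).obj T ≅ splitTorus U d) [Flat f]
    [LocallyOfFinitePresentation f] [Surjective f] (p : ℕ) [CharP (ResidueField R) p] {N : ℕ}
    (hN : maximalIdeal R ^ N = ⊥) {X : Over (Spec (CommRingCat.of R))} {x : Sec T X}
    (hx : VanishesMod x) : p ^ N • x = 0 := by
  have hthr : throughSieve X (Over.mk f) ∈ topo _ X := by
    have : Flat (Over.mk f).hom := ‹Flat f›
    have : LocallyOfFinitePresentation (Over.mk f).hom := ‹LocallyOfFinitePresentation f›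
    have : Surjective (Over.mk f).hom := ‹Surjective f›
    exact throughSieve_mem X (Over.mk f)
  apply sec_ext_aff T hthr
  rintro C g k ⟨h⟩
  rw [map_zero, map_nsmul]
  have h₀ := (vanishesMod_iff _).1 (hx.res k)
  apply secTorus_eq_zero e h
  intro j
  rw [secTorus_nsmul]
  apply Units.ext
  rw [Units.val_pow_eq_pow_val, Units.val_one]
  apply pow_pow_eq_one (natCast_mem_redIdeal p) (redIdeal_pow (g := g) hN)
  rw [← Ideal.Quotient.eq_zero_iff_mem, map_sub, map_one, sub_eq_zero]
  have h₁ := secTorus_res e (redIncl g) h _ rfl (res T k x) j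
  rw [h₀, map_zero] at h₁
  exact (congrArg Units.val h₁).symm

end Torus

/-! ### Generating sections of a locally constant group -/

section Generators

variable {S : Scheme.{u}}

/-- Local sections which are characterized by a property glue. -/
theorem exists_glue_of_rel (F : FppfAb S) (X : Over S)
    (Q : ∀ {Y : Over S}, (Y ⟶ X) → Sec F Y → Prop)
    (hres : ∀ {Y Z : Over S} (k : Y ⟶ X) (l : Z ⟶ Y) (y : Sec F Y),
      Q k y → Q (l ≫ k) (res F l y))
    (huniq : ∀ {Y : Over S} (k : Y ⟶ X) (y y' : Sec F Y), Q k y → Q k y' → y = y')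
    {s : Sieve X} (hs : s ∈ topo S X) (hex : ∀ {Y : Over S} (k : Y ⟶ X), s k → ∃ y, Q k y) :
    ∃ x : Sec F X, ∀ {Y : Over S} (k : Y ⟶ X) (y : Sec F Y), Q k y → res F k x = y := by
  obtain ⟨x, hx⟩ := sec_glue F hs (fun Y k hk => (hex k hk).choose) (by
    intro Y Z g hg h
    exact huniq _ _ _ (hres g h _ (hex g hg).choose_spec)
      (hex (h ≫ g) (s.downward_closed hg h)).choose_spec)
  refine ⟨x, fun {Y} k y hy => ?_⟩
  apply sec_ext F ((topo S).pullback_stable k hs)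
  intro Z l hl
  rw [res_res, hx _ _ hl]
  exact huniq _ _ _ (hex _ hl).choose_spec (hres k l y hy)

/-- The sections `ℓ a` over `V` generate `L` over `V` as a constant sheaf. -/
structure IsGenerating {L : FppfAb S} {V : Over S} {A : Type} [AddCommGroup A]
    (ℓ : A →+ Sec L V) : Prop where
  gen : ∀ {X : Over S} (h : X ⟶ V) (x : Sec L X), ∃ s ∈ topo S X, ∀ {Y : Over S} (k : Y ⟶ X),
    s k → ∃ a, res L k x = res L (k ≫ h) (ℓ a)
  -- The conclusion `a = 0` is required only on members of a cover: over the empty scheme every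
  -- section vanishes, and there the empty sieve is covering.
  sep : ∀ {X : Over S} (h : X ⟶ V) (a : A), res L h (ℓ a) = 0 → ∃ s ∈ topo S X,
    ∀ {Y : Over S} (k : Y ⟶ X), s k → a = 0

theorem IsGenerating.comp {L : FppfAb S} {V W : Over S} {A : Type} [AddCommGroup A]
    {ℓ : A →+ Sec L V} (hℓ : IsGenerating ℓ) (j : W ⟶ V) :
    IsGenerating ((res L j).comp ℓ) where
  gen h x := by
    obtain ⟨s, hs, H⟩ := hℓ.gen (h ≫ j) x
    refine ⟨s, hs, fun k hk => ?_⟩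
    obtain ⟨a, ha⟩ := H k hk
    refine ⟨a, ?_⟩
    rw [ha, AddMonoidHom.comp_apply, res_res, Category.assoc]
  sep h a ha := by
    rw [AddMonoidHom.comp_apply, res_res] at ha
    exact hℓ.sep (h ≫ j) a ha

theorem IsGenerating.res_eq {L F : FppfAb S} {V : Over S} {A : Type} [AddCommGroup A]
    {ℓ : A →+ Sec L V} (hℓ : IsGenerating ℓ) (y : A →+ Sec F V) {X : Over S} (h : X ⟶ V) {a b : A}
    (hab : res L h (ℓ a) = res L h (ℓ b)) : res F h (y a) = res F h (y b) := by
  obtain ⟨s, hs, H⟩ := hℓ.sep h (a - b) (by rw [map_sub, map_sub, hab, sub_self])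
  apply sec_ext F hs
  intro Y k hk
  rw [sub_eq_zero.1 (H k hk)]

/-- A morphism out of `L` on the sections over a `V`-scheme, from its values on generators. -/
theorem IsGenerating.exists_sec {L F : FppfAb S} {V : Over S} {A : Type} [AddCommGroup A]
    {ℓ : A →+ Sec L V} (hℓ : IsGenerating ℓ) (y : A →+ Sec F V) {X : Over S} (h : X ⟶ V)
    (x : Sec L X) : ∃ z : Sec F X, ∀ {Y : Over S} (k : Y ⟶ X) (b : A),
      res L k x = res L (k ≫ h) (ℓ b) → res F k z = res F (k ≫ h) (y b) := by
  obtain ⟨s, hs, H⟩ := hℓ.gen h x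
  obtain ⟨z, hz⟩ := exists_glue_of_rel F X
    (fun {Y} k z => ∃ b, res L k x = res L (k ≫ h) (ℓ b) ∧ z = res F (k ≫ h) (y b))
    (by
      rintro Y Z k l _ ⟨b, hb, rfl⟩
      refine ⟨b, ?_, ?_⟩
      · rw [← res_res, hb, res_res, Category.assoc]
      · rw [res_res, Category.assoc])
    (by
      rintro Y k _ _ ⟨b, hb, rfl⟩ ⟨c, hc, rfl⟩
      exact hℓ.res_eq y _ (hb.symm.trans hc))
    hs
    (fun k hk => ⟨_, (H k hk).choose, (H k hk).choose_spec, rfl⟩)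
  exact ⟨z, fun k b hb => hz k _ ⟨b, hb, rfl⟩⟩

/-- The constant sections of `ℤ^r`. -/
def constSec (U : Scheme.{u}) (r : ℕ) (X : Over U) : (Fin r → ℤ) →+ Sec (constLattice U r) X :=
  ((toSheafify (topo U) ((Functor.const (Over U)ᵒᵖ).obj
    (AddCommGrpCat.of (ULift.{u + 1} (Fin r → ℤ))))).app (op X)).hom.comp
    (AddEquiv.ulift.symm : (Fin r → ℤ) ≃+ ULift.{u + 1} (Fin r → ℤ)).toAddMonoidHom

theorem res_constSec (U : Scheme.{u}) (r : ℕ) {X Y : Over U} (k : Y ⟶ X) (a : Fin r → ℤ) :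
    res _ k (constSec U r X a) = constSec U r Y a :=
  (ConcreteCategory.congr_hom ((toSheafify (topo U) ((Functor.const (Over U)ᵒᵖ).obj
    (AddCommGrpCat.of (ULift.{u + 1} (Fin r → ℤ))))).naturality k.op) (ULift.up a)).symm

theorem constSec_gen (U : Scheme.{u}) (r : ℕ) {X : Over U} (x : Sec (constLattice U r) X) :
    ∃ s ∈ topo U X, ∀ {Y : Over U} (k : Y ⟶ X), s k → ∃ a, res _ k x = constSec U r Y a := by
  refine ⟨_, Presheaf.imageSieve_mem (topo U) (toSheafify (topo U)
    ((Functor.const (Over U)ᵒᵖ).obj (AddCommGrpCat.of (ULift.{u + 1} (Fin r → ℤ))))) x, ?_⟩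
  rintro Y k ⟨a, ha⟩
  exact ⟨a.down, ha.symm⟩

theorem constSec_sep (U : Scheme.{u}) (r : ℕ) {X : Over U} (a : Fin r → ℤ)
    (ha : constSec U r X a = 0) : ∃ s ∈ topo U X, ∀ {Y : Over U} (k : Y ⟶ X), s k → a = 0 := by
  let η := toSheafify (topo U) ((Functor.const (Over U)ᵒᵖ).obj
    (AddCommGrpCat.of (ULift.{u + 1} (Fin r → ℤ))))
  refine ⟨_, Presheaf.equalizerSieve_mem (topo U) η (X := op X) (ULift.up a) (ULift.up 0) ?_, ?_⟩
  · exact ha.trans (map_zero (constSec U r X)).symm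
  · intro Y k hk
    exact ULift.up_injective hk

/-- A sieve on an object over `U`, seen over `S`. -/
theorem exists_sieve_of_lower {U : Scheme.{u}} {f : U ⟶ S} {X : Over S} (h : X ⟶ Over.mk f)
    (s : Sieve (lower h)) (hs : s ∈ topo U (lower h)) : ∃ t ∈ topo S X, ∀ {Y : Over S} (k : Y ⟶ X),
      t k → s (lowerMap k h) := by
  refine ⟨(Sieve.overEquiv X).symm (Sieve.overEquiv (lower h) s), ?_, ?_⟩
  -- Both objects have the same underlying scheme, and whether a sieve covers is decided there.
  · rw [GrothendieckTopology.mem_over_iff]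
    refine (congrArg (· ∈ Scheme.fppfTopology X.left)
      ((Sieve.overEquiv X).apply_symm_apply (Sieve.overEquiv (lower h) s))).mpr ?_
    exact (GrothendieckTopology.mem_over_iff _ _).1 hs
  · intro Y k hk
    exact (Sieve.overEquiv_iff _ _).1 ((Sieve.overEquiv_symm_iff _ _).1 hk)

/-- A constant group has generating sections. -/
theorem exists_isGenerating {L : FppfAb S} {U : Scheme.{u}} {f : U ⟶ S} {r : ℕ}
    (e : (baseChange f).obj L ≅ constLattice U r) :
    ∃ ℓ : (Fin r → ℤ) →+ Sec L (Over.mk f), IsGenerating ℓ := by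
  let c {X : Over S} (h : X ⟶ Over.mk f) : Sec L X ≃+ Sec (constLattice U r) (lower h) :=
    (secLower L h).trans (evEquiv e (lower h))
  have hc {X Y : Over S} (k : Y ⟶ X) (h : X ⟶ Over.mk f) (x : Sec L X) :
      c (k ≫ h) (res L k x) = res _ (lowerMap k h) (c h x) := by
    change ev e.hom _ (secLower L (k ≫ h) (res L k x)) = _
    rw [secLower_res]
    exact ev_res e.hom (lowerMap k h) _
  let ℓ : (Fin r → ℤ) →+ Sec L (Over.mk f) :=
    (c (𝟙 _)).symm.toAddMonoidHom.comp (constSec U r _)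
  have hℓ {X : Over S} (h : X ⟶ Over.mk f) (a : Fin r → ℤ) :
      c h (res L h (ℓ a)) = constSec U r _ a := by
    -- The type of `c h` depends on `h`, so `h` is generalized before it is replaced by `h ≫ 𝟙`.
    have key : ∀ h', h' = h ≫ 𝟙 _ → c h' (res L h' (ℓ a)) = constSec U r _ a := by
      rintro _ rfl
      rw [← res_res, res_id, hc, show c (𝟙 _) (ℓ a) = constSec U r _ a from
        (c (𝟙 _)).apply_symm_apply _, res_constSec]
    exact key h (Category.comp_id h).symm
  refine ⟨ℓ, ?_, ?_⟩
  · intro X h x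
    obtain ⟨s, hs, H⟩ := constSec_gen U r (c h x)
    obtain ⟨t, ht, ht'⟩ := exists_sieve_of_lower h s hs
    refine ⟨t, ht, fun k hk => ?_⟩
    obtain ⟨a, ha⟩ := H _ (ht' k hk)
    refine ⟨a, (c (k ≫ h)).injective ?_⟩
    rw [hc, ha, hℓ]
  · intro X h a ha
    obtain ⟨s, hs, H⟩ := constSec_sep U r (X := lower h) a (by rw [← hℓ h a, ha, map_zero])
    obtain ⟨t, ht, ht'⟩ := exists_sieve_of_lower h s hs
    exact ⟨t, ht, fun k hk => H _ (ht' k hk)⟩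

/-- Locally a section comes from some `a : A`, and `m • a = 0` forces `a = 0` because `A` is
torsion-free. -/
theorem IsGenerating.mono_smul {L : FppfAb S} {V : Over S} [Flat V.hom]
    [LocallyOfFinitePresentation V.hom] [Surjective V.hom] {A : Type} [AddCommGroup A]
    [IsAddTorsionFree A] {ℓ : A →+ Sec L V} (hℓ : IsGenerating ℓ) {m : ℕ} (hm : m ≠ 0) :
    Mono (m • 𝟙 L) := by
  apply mono_of_sec
  intro X x hx
  rw [ev_nsmul, ev_id] at hx
  apply sec_ext L (throughSieve_mem X V)
  rintro Y g ⟨h⟩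
  obtain ⟨s, hs, H⟩ := hℓ.gen h (res L g x)
  apply sec_ext L hs
  intro Z k hk
  obtain ⟨a, ha⟩ := H k hk
  obtain ⟨t, ht, H'⟩ := hℓ.sep (k ≫ h) (m • a) (by
    rw [map_nsmul, map_nsmul, ← ha, ← map_nsmul, ← map_nsmul, hx, map_zero, map_zero])
  apply sec_ext L ht
  intro W l hl
  rw [ha, (smul_eq_zero.1 (H' l hl)).resolve_left hm]
  simp

/-- Morphisms which agree on generators are equal. -/
theorem IsGenerating.hom_ext {L F : FppfAb S} {V : Over S} [Flat V.hom]
    [LocallyOfFinitePresentation V.hom] [Surjective V.hom] {A : Type} [AddCommGroup A]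
    {ℓ : A →+ Sec L V} (hℓ : IsGenerating ℓ) {φ ψ : L ⟶ F}
    (h : ∀ a, ev φ V (ℓ a) = ev ψ V (ℓ a)) : φ = ψ := by
  apply hom_ext_sec
  intro X x
  apply sec_ext F (throughSieve_mem X V)
  rintro Y g ⟨j⟩
  obtain ⟨s, hs, H⟩ := hℓ.gen j (res L g x)
  apply sec_ext F hs
  intro Z k hk
  obtain ⟨a, ha⟩ := H k hk
  rw [← ev_res, ← ev_res, ← ev_res, ← ev_res, ha, ev_res, ev_res, h]

end Generators

/-! ### Homomorphisms out of a lattice by étale descent -/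

section Descent

variable {S : Scheme.{u}}

theorem IsGenerating.exists_cover {L : FppfAb S} {V : Over S} [Flat V.hom]
    [LocallyOfFinitePresentation V.hom] [Surjective V.hom] {A : Type} [AddCommGroup A]
    {ℓ : A →+ Sec L V} (hℓ : IsGenerating ℓ) {X : Over S} (x : Sec L X) :
    ∃ s ∈ topo S X, ∀ {Y : Over S} (k : Y ⟶ X), s k →
      ∃ (h : Y ⟶ V) (a : A), res L k x = res L h (ℓ a) := by
  let s : Sieve X :=
    { arrows := fun Y k => ∃ (h : Y ⟶ V) (a : A), res L k x = res L h (ℓ a)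
      downward_closed := by
        rintro Y Z k ⟨h, a, ha⟩ l
        exact ⟨l ≫ h, a, by rw [← res_res, ha, res_res]⟩ }
  refine ⟨s, (topo S).transitive (throughSieve_mem X V) s ?_, fun k hk => hk⟩
  rintro Y g ⟨j⟩
  obtain ⟨t, ht, H⟩ := hℓ.gen j (res L g x)
  refine (topo S).superset_covering ?_ ht
  intro Z k hk
  obtain ⟨a, ha⟩ := H k hk
  exact ⟨k ≫ j, a, by rw [← ha, res_res]⟩

/-- A morphism out of `L` from compatible values on generators. -/
theorem IsGenerating.exists_hom {L F : FppfAb S} {V : Over S} [Flat V.hom]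
    [LocallyOfFinitePresentation V.hom] [Surjective V.hom] {A : Type} [AddCommGroup A]
    {ℓ : A →+ Sec L V} (hℓ : IsGenerating ℓ) (y : A →+ Sec F V)
    (hy : ∀ {Y : Over S} (h h' : Y ⟶ V) (a b : A), res L h (ℓ a) = res L h' (ℓ b) →
      res F h (y a) = res F h' (y b)) : ∃ φ : L ⟶ F, ∀ a, ev φ V (ℓ a) = y a := by
  have key (X : Over S) (x : Sec L X) : ∃ z : Sec F X, ∀ {Y : Over S} (k : Y ⟶ X) (h : Y ⟶ V)
      (a : A), res L k x = res L h (ℓ a) → res F k z = res F h (y a) := by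
    obtain ⟨s, hs, H⟩ := hℓ.exists_cover x
    obtain ⟨z, hz⟩ := exists_glue_of_rel F X
      (fun {Y} k z => ∃ (h : Y ⟶ V) (a : A), res L k x = res L h (ℓ a) ∧ z = res F h (y a))
      (by
        rintro Y Z k l _ ⟨h, a, ha, rfl⟩
        exact ⟨l ≫ h, a, by rw [← res_res, ha, res_res], by rw [res_res]⟩)
      (by
        rintro Y k _ _ ⟨h, a, ha, rfl⟩ ⟨h', b, hb, rfl⟩
        exact hy _ _ _ _ (ha.symm.trans hb))
      hs
      (fun k hk => ⟨_, (H k hk).choose, (H k hk).choose_spec.choose,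
        (H k hk).choose_spec.choose_spec, rfl⟩)
    exact ⟨z, fun k h a ha => hz k _ ⟨h, a, ha, rfl⟩⟩
  choose Φ hΦ using key
  have hadd (X : Over S) (x x' : Sec L X) : Φ X (x + x') = Φ X x + Φ X x' := by
    obtain ⟨s, hs, H⟩ := hℓ.exists_cover x
    apply sec_ext F hs
    intro Y k hk
    obtain ⟨h, a, ha⟩ := H k hk
    obtain ⟨t, ht, H'⟩ := hℓ.gen h (res L k x')
    apply sec_ext F ht
    intro Z l hl
    obtain ⟨b, hb⟩ := H' l hl
    have ha' : res L (l ≫ k) x = res L (l ≫ h) (ℓ a) := by rw [← res_res, ha, res_res]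
    rw [res_res] at hb
    rw [res_res, res_res, map_add, hΦ X x _ _ _ ha', hΦ X x' _ _ _ hb,
      hΦ X (x + x') (l ≫ k) (l ≫ h) (a + b) (by rw [map_add, ha', hb, map_add, map_add]),
      map_add, map_add]
  have hnat {X Y : Over S} (g : Y ⟶ X) (x : Sec L X) : Φ Y (res L g x) = res F g (Φ X x) := by
    obtain ⟨s, hs, H⟩ := hℓ.exists_cover (res L g x)
    apply sec_ext F hs
    intro Z k hk
    obtain ⟨h, a, ha⟩ := H k hk
    rw [hΦ Y _ k h a ha, res_res, hΦ X x (k ≫ g) h a (by rw [← ha, res_res])]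
  let φ : L ⟶ F := ⟨
    { app := fun X => AddCommGrpCat.ofHom (AddMonoidHom.mk' (Φ X.unop) (hadd X.unop))
      naturality := by
        intro X Y g
        ext x
        exact hnat g.unop x }⟩
  refine ⟨φ, fun a => ?_⟩
  have h := hΦ V (ℓ a) (𝟙 V) (𝟙 V) a rfl
  rw [res_id, res_id] at h
  exact h

/-- Families of morphisms out of `L` exist if their values are characterized by a local property
which has a unique solution on affine étale coverings. -/
theorem IsGenerating.exists_hom_of_unique {L F : FppfAb S} {C : CommRingCat.{u}} {v : Spec C ⟶ S}
    [Etale v] [Surjective v] {A : Type} [AddCommGroup A] {ℓ : A →+ Sec L (aff v)}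
    (hℓ : IsGenerating ℓ) (P : ∀ (X : Over S), Sec L X → (ℕ → Sec F X) → Prop)
    (hres : ∀ {X Y : Over S} (g : Y ⟶ X) (x : Sec L X) (y : ℕ → Sec F X), P X x y →
      P Y (res L g x) (fun n => res F g (y n)))
    (hadd : ∀ {X : Over S} (x x' : Sec L X) (y y' : ℕ → Sec F X), P X x y → P X x' y' →
      P X (x + x') (y + y'))
    (hloc : ∀ {X : Over S} (x : Sec L X) (y : ℕ → Sec F X) (s : Sieve X), s ∈ topo S X →
      (∀ {Y : Over S} (g : Y ⟶ X), s g → P Y (res L g x) (fun n => res F g (y n))) → P X x y)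
    (huniq : ∀ {D : CommRingCat.{u}} (g : Spec D ⟶ S) [Etale g] (_ : aff g ⟶ aff v)
      (x : Sec L (aff g)) (y y' : ℕ → Sec F (aff g)), P _ x y → P _ x y' → y = y')
    (hex : ∀ {D : CommRingCat.{u}} (g : Spec D ⟶ S) [Etale g] (_ : aff g ⟶ aff v)
      (x : Sec L (aff g)), ∃ y : ℕ → Sec F (aff g), P _ x y) :
    ∃ φ : ℕ → (L ⟶ F), ∀ (X : Over S) (x : Sec L X), P X x (fun n => ev (φ n) X x) := by
  have : Flat (aff v).hom := inferInstanceAs (Flat v)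
  have : LocallyOfFinitePresentation (aff v).hom :=
    inferInstanceAs (LocallyOfFinitePresentation v)
  have : Surjective (aff v).hom := inferInstanceAs (Surjective v)
  choose y₀ hy₀ using fun a => hex v (𝟙 _) (ℓ a)
  have hy₀' (a b : A) : y₀ (a + b) = y₀ a + y₀ b := by
    refine huniq v (𝟙 _) (ℓ (a + b)) _ _ (hy₀ _) ?_
    rw [map_add]
    exact hadd _ _ _ _ (hy₀ a) (hy₀ b)
  let y (n : ℕ) : A →+ Sec F (aff v) :=
    AddMonoidHom.mk' (fun a => y₀ a n) (fun a b => congrFun (hy₀' a b) n)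
  -- `P` holds for any pair that is locally a pullback of a generator and its chosen values;
  -- uniqueness can then be applied to such glued values.
  have hgood {X : Over S} (x : Sec L X) (z : ℕ → Sec F X) (s : Sieve X) (hs : s ∈ topo S X)
      (H : ∀ {Y : Over S} (k : Y ⟶ X), s k → ∃ (h : Y ⟶ aff v) (a : A),
        res L k x = res L h (ℓ a) ∧ ∀ n, res F k (z n) = res F h (y n a)) : P X x z := by
    refine hloc x z s hs fun {Y} k hk => ?_
    obtain ⟨h, a, ha, ha'⟩ := H k hk
    rw [ha, funext ha']
    exact hres h _ _ (hy₀ a)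
  -- The descent condition. It suffices to check it on affine opens of `Spec C ×_S Spec C`; these
  -- are étale over `S`, so uniqueness is available there.
  have key {Y : Over S} (h h' : Y ⟶ aff v) (a b : A) (hab : res L h (ℓ a) = res L h' (ℓ b))
      (n : ℕ) : res F h (y n a) = res F h' (y n b) := by
    let W : Over S := Over.mk (pullback.fst v v ≫ v)
    let p₁ : W ⟶ aff v := Over.homMk (pullback.fst v v)
    let p₂ : W ⟶ aff v := Over.homMk (pullback.snd v v) pullback.condition.symm
    have hw : h.left ≫ v = h'.left ≫ v := (Over.w h).trans (Over.w h').symm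
    obtain ⟨m₀, hm₀₁, hm₀₂⟩ : ∃ m₀ : Y.left ⟶ pullback v v,
        m₀ ≫ pullback.fst v v = h.left ∧ m₀ ≫ pullback.snd v v = h'.left :=
      ⟨pullback.lift h.left h'.left hw, pullback.lift_fst _ _ _, pullback.lift_snd _ _ _⟩
    let l : Y ⟶ W := Over.homMk m₀ (by
      change m₀ ≫ pullback.fst v v ≫ v = Y.hom
      rw [reassoc_of% hm₀₁]
      exact Over.w h)
    have hl₁ : l ≫ p₁ = h := by
      ext : 1
      exact hm₀₁
    have hl₂ : l ≫ p₂ = h' := by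
      ext : 1
      exact hm₀₂
    apply sec_ext F ((topo S).pullback_stable l (affineSieve_mem W))
    rintro Z g ⟨D, j, hj, m, hm⟩
    have : Etale (j ≫ W.hom) := by
      have : Etale W.hom := inferInstanceAs (Etale (pullback.fst v v ≫ v))
      infer_instance
    let k : aff (j ≫ W.hom) ⟶ W := Over.homMk j
    have hm₁ : m ≫ k ≫ p₁ = g ≫ h := by rw [← hl₁, ← Category.assoc, ← hm, Category.assoc]
    have hm₂ : m ≫ k ≫ p₂ = g ≫ h' := by rw [← hl₂, ← Category.assoc, ← hm, Category.assoc]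
    -- The first pullback of `ℓ a` is locally a second pullback of a generator, which gives it a
    -- value computed through `p₂`. That value satisfies `P`, so it equals the value computed
    -- through `p₁`.
    choose z hz using fun n => hℓ.exists_sec (y n) (k ≫ p₂) (res L (k ≫ p₁) (ℓ a))
    have hz' : P _ (res L (k ≫ p₁) (ℓ a)) z := by
      obtain ⟨s, hs, H⟩ := hℓ.gen (k ≫ p₂) (res L (k ≫ p₁) (ℓ a))
      refine hgood _ _ s hs fun {Y} k' hk' => ?_
      obtain ⟨c, hc⟩ := H k' hk'
      exact ⟨_, c, hc, fun n => hz n k' c hc⟩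
    have hz'' := huniq (j ≫ W.hom) (k ≫ p₁) _ _ _ hz' (hres (k ≫ p₁) _ _ (hy₀ a))
    have hm₃ := hz n m b (by rw [res_res, hm₁, hm₂, ← res_res, ← res_res, hab])
    rw [hz'', hm₂] at hm₃
    rw [res_res, res_res, ← hm₃, ← hm₁]
    exact (res_res F _ _ _).symm
  choose φ hφ using fun n => hℓ.exists_hom (y n) (fun h h' a b hab => key h h' a b hab n)
  refine ⟨φ, fun X x => ?_⟩
  obtain ⟨s, hs, H⟩ := hℓ.exists_cover x
  refine hgood _ _ s hs fun {Y} k hk => ?_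
  obtain ⟨h, a, ha⟩ := H k hk
  exact ⟨h, a, ha, fun n => by rw [← ev_res, ha, ev_res, hφ]⟩

end Descent

/-! ### Common splitting, and the canonical family lifting `u₀` -/

section Splitting

open IsLocalRing

variable {R : Type u} [CommRing R] [IsLocalRing R]

/-- A torus and a lattice over an artinian local ring split over a common affine étale covering. -/
theorem exists_splitting [IsArtinianRing R] {T L : FppfAb (Spec (CommRingCat.of R))}
    (hT : IsTorus T) (hL : IsLattice L) :
    ∃ (U : Scheme.{u}) (f : U ⟶ Spec (CommRingCat.of R)) (_ : Etale f) (_ : Surjective f) (d : ℕ)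
      (_ : (baseChange f).obj T ≅ splitTorus U d) (C : CommRingCat.{u})
      (v : Spec C ⟶ Spec (CommRingCat.of R)) (_ : Etale v) (_ : Surjective v)
      (_ : aff v ⟶ Over.mk f) (r : ℕ) (ℓ : (Fin r → ℤ) →+ Sec L (aff v)), IsGenerating ℓ := by
  -- The base is a single point, so every nonempty scheme over it surjects onto it, and one affine
  -- open of the fibre product is enough.
  have hS : Subsingleton (Spec (CommRingCat.of R)) :=
    inferInstanceAs (Subsingleton (PrimeSpectrum R))
  let s : Spec (CommRingCat.of R) := IsLocalRing.closedPoint R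
  obtain ⟨U, f, hf, ⟨a, ha⟩, d, ⟨e⟩⟩ := hT s
  obtain ⟨U', f', hf', ⟨a', ha'⟩, r, ⟨e'⟩⟩ := hL s
  have hsf : Surjective f := ⟨fun x => ⟨a, Subsingleton.elim _ _⟩⟩
  have hsf' : Surjective f' := ⟨fun x => ⟨a', Subsingleton.elim _ _⟩⟩
  obtain ⟨b, -⟩ := (pullback.fst f f').surjective a
  let W : Scheme.{u} := pullback f f'
  let c := W.affineOpenCover.idx b
  obtain ⟨b', -⟩ := W.affineOpenCover.covers b
  let j : Spec (W.affineOpenCover.X c) ⟶ W := W.affineOpenCover.f c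
  have hw : pullback.fst f f' ≫ f = pullback.snd f f' ≫ f' := pullback.condition
  let v : Spec (W.affineOpenCover.X c) ⟶ Spec (CommRingCat.of R) := j ≫ pullback.fst f f' ≫ f
  obtain ⟨ℓ, hℓ⟩ := exists_isGenerating e'
  let t' : aff v ⟶ Over.mk f' := Over.homMk (j ≫ pullback.snd f f') (by
    change (j ≫ pullback.snd f f') ≫ f' = j ≫ pullback.fst f f' ≫ f
    rw [Category.assoc, hw])
  exact ⟨U, f, hf, hsf, d, e, _, v, inferInstanceAs (Etale (j ≫ pullback.fst f f' ≫ f)),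
    ⟨fun x => ⟨b', Subsingleton.elim _ _⟩⟩, Over.homMk (j ≫ pullback.fst f f') rfl, r, _,
    hℓ.comp t'⟩

theorem perfectRing_redRing {C : CommRingCat.{u}} (g : Spec C ⟶ Spec (CommRingCat.of R)) [Etale g]
    (p : ℕ) [Fact p.Prime] [CharP (ResidueField R) p] [PerfectField (ResidueField R)] :
    PerfectRing (redRing g) p := by
  have h : (Spec.preimage g).hom.Etale := by
    rw [← HasRingHomProperty.Spec_iff (P := @Etale), Spec.map_preimage]
    infer_instance
  let : Algebra R C := (Spec.preimage g).hom.toAlgebra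
  have : Algebra.Etale R C := h
  exact perfectRing_quotient_of_etale R C p

/-- Sections over the closed fibre which agree locally are equal. -/
theorem sec_ext_closed (F : FppfAb (Spec (CommRingCat.of R))) {D : CommRingCat.{u}}
    {z : Spec D ⟶ Spec (CommRingCat.of (ResidueField R))} {s : Sieve (aff (z ≫ closedPt R))}
    (hs : s ∈ topo _ (aff (z ≫ closedPt R))) {x y : Sec F (aff (z ≫ closedPt R))}
    (h : ∀ {D' : CommRingCat.{u}} {z' : Spec D' ⟶ Spec (CommRingCat.of (ResidueField R))}
      (b : aff z' ⟶ aff z), s ((Over.map (closedPt R)).map b) →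
        res F ((Over.map (closedPt R)).map b) x = res F ((Over.map (closedPt R)).map b) y) :
    x = y := by
  apply sec_ext_aff F hs
  intro C g k hk
  have hw : k.left ≫ z ≫ closedPt R = g := Over.w k
  -- The two structure morphisms are equal only propositionally; `i` and `i'` are the identity of
  -- `Spec C` in the two directions.
  let i : aff g ⟶ aff ((k.left ≫ z) ≫ closedPt R) := Over.homMk (𝟙 _) (by
    change 𝟙 _ ≫ (k.left ≫ z) ≫ closedPt R = g
    rw [Category.id_comp, Category.assoc, hw])
  let i' : aff ((k.left ≫ z) ≫ closedPt R) ⟶ aff g := Over.homMk (𝟙 _) (by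
    change 𝟙 _ ≫ g = (k.left ≫ z) ≫ closedPt R
    rw [Category.id_comp, Category.assoc, hw])
  let b : aff (k.left ≫ z) ⟶ aff z := Over.homMk k.left
  have hb : (Over.map (closedPt R)).map b = i' ≫ k := by
    ext : 1
    exact (Category.id_comp _).symm
  have hi : k = i ≫ (Over.map (closedPt R)).map b := by
    ext : 1
    exact (Category.id_comp _).symm
  have h' := h b (by rw [hb]; exact s.downward_closed hk i')
  rw [hi, ← res_res, ← res_res]
  exact congrArg (res F i) h'

variable {T L : FppfAb (Spec (CommRingCat.of R))} {U : Scheme.{u}}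
  {f : U ⟶ Spec (CommRingCat.of R)} {d : ℕ}

/-- The closed fibre of an étale affine scheme is perfect, so `p ^ n` is injective on its torus
points. -/
theorem vanishesMod_of_pow_smul (e : (baseChange f).obj T ≅ splitTorus U d) {p : ℕ}
    [Fact p.Prime] [CharP (ResidueField R) p] [PerfectField (ResidueField R)]
    {C : CommRingCat.{u}} {g : Spec C ⟶ Spec (CommRingCat.of R)} [Etale g]
    (h : aff g ⟶ Over.mk f) {n : ℕ} {x : Sec T (aff g)} (hx : VanishesMod (p ^ n • x)) :
    VanishesMod x := by
  rw [vanishesMod_iff] at hx ⊢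
  have := perfectRing_redRing g p
  apply (bijective_pow_smul_torus e (redIncl g ≫ h) (Fact.out : p.Prime).ne_zero n).1
  beta_reduce
  rw [← map_nsmul, hx, smul_zero]

/-- Morphisms over the closed fibre, as maps on sections. -/
abbrev ev₀ (u₀ : (baseChange (closedPt R)).obj L ⟶ (baseChange (closedPt R)).obj T)
    {D : CommRingCat.{u}} (z : Spec D ⟶ Spec (CommRingCat.of (ResidueField R))) :
    Sec L (aff (z ≫ closedPt R)) →+ Sec T (aff (z ≫ closedPt R)) :=
  ev u₀ (aff z)

theorem ev₀_res (u₀ : (baseChange (closedPt R)).obj L ⟶ (baseChange (closedPt R)).obj T)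
    {D D' : CommRingCat.{u}} {z : Spec D ⟶ Spec (CommRingCat.of (ResidueField R))}
    {z' : Spec D' ⟶ Spec (CommRingCat.of (ResidueField R))} (b : aff z' ⟶ aff z)
    (x : Sec L (aff (z ≫ closedPt R))) :
    ev₀ u₀ z' (res L ((Over.map (closedPt R)).map b) x) =
      res T ((Over.map (closedPt R)).map b) (ev₀ u₀ z x) :=
  ev_res u₀ b x

/-- A homomorphism over the residue field from a lattice to a torus lifts to a `p`-divisible system
of homomorphisms. -/
theorem exists_family_torus (e : (baseChange f).obj T ≅ splitTorus U d) [Flat f]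
    [LocallyOfFinitePresentation f] [Surjective f] (p : ℕ) [Fact p.Prime]
    [CharP (ResidueField R) p] [PerfectField (ResidueField R)] {N : ℕ}
    (hN : maximalIdeal R ^ N = ⊥) {C : CommRingCat.{u}} {v : Spec C ⟶ Spec (CommRingCat.of R)}
    [Etale v] [Surjective v] (t : aff v ⟶ Over.mk f) {A : Type} [AddCommGroup A]
    {ℓ : A →+ Sec L (aff v)} (hℓ : IsGenerating ℓ)
    (u₀ : (baseChange (closedPt R)).obj L ⟶ (baseChange (closedPt R)).obj T) :
    ∃ φ : ℕ → (L ⟶ T), (∀ n, p • φ (n + 1) = φ n) ∧ (baseChange (closedPt R)).map (φ 0) = u₀ := by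
  have hp : p ≠ 0 := (Fact.out : p.Prime).ne_zero
  let P (X : Over (Spec (CommRingCat.of R))) (x : Sec L X) (y : ℕ → Sec T X) : Prop :=
    (∀ n, p • y (n + 1) = y n) ∧ ∀ {D : CommRingCat.{u}}
      (z : Spec D ⟶ Spec (CommRingCat.of (ResidueField R))) (a : aff (z ≫ closedPt R) ⟶ X),
      res T a (y 0) = ev₀ u₀ z (res L a x)
  suffices key : ∃ φ : ℕ → (L ⟶ T), ∀ X x, P X x (fun n => ev (φ n) X x) by
    obtain ⟨φ, hφ⟩ := key
    refine ⟨φ, fun n => ?_, ?_⟩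
    · apply hom_ext_sec
      intro X x
      rw [ev_nsmul]
      exact (hφ X x).1 n
    · apply hom_ext_sec
      intro Z x
      apply sec_ext_aff _ ((topo _).top_mem Z)
      intro D z k _
      have h := (hφ _ x).2 z ((Over.map (closedPt R)).map k)
      exact h.trans (ev_res u₀ k x)
  refine hℓ.exists_hom_of_unique P ?_ ?_ ?_ ?_ ?_
  · rintro X Y g x y ⟨h₁, h₂⟩
    refine ⟨fun n => by rw [← map_nsmul, h₁], fun z a => ?_⟩
    rw [res_res, res_res]
    exact h₂ z _
  · rintro X x x' y y' ⟨h₁, h₂⟩ ⟨h₁', h₂'⟩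
    refine ⟨fun n => ?_, fun z a => ?_⟩
    · rw [Pi.add_apply, smul_add, h₁, h₁', Pi.add_apply]
    · rw [Pi.add_apply, map_add, h₂ z a, h₂' z a, map_add, map_add]
  · intro X x y s hs H
    refine ⟨fun n => ?_, fun {D} z a => ?_⟩
    · apply sec_ext T hs
      intro Y g hg
      rw [map_nsmul]
      exact (H g hg).1 n
    · apply sec_ext_closed T ((topo _).pullback_stable a hs)
      intro D' z' b hb
      have h := ((res_id T _).symm.trans ((H _ hb).2 z' (𝟙 _))).trans
        (congrArg (ev₀ u₀ z') (res_id L _))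
      rw [← ev₀_res]
      refine (res_res T _ _ _).trans (h.trans ?_)
      exact congrArg (ev₀ u₀ z') (res_res L _ _ _).symm
  · rintro D g hg h x y y' ⟨h₁, h₂⟩ ⟨h₁', h₂'⟩
    have hw : ∀ n, p • (y - y') (n + 1) = (y - y') n := fun n => by
      rw [Pi.sub_apply, smul_sub, h₁, h₁', Pi.sub_apply]
    have hw' : ∀ n m, p ^ n • (y - y') (m + n) = (y - y') m := by
      intro n m
      induction n with
      | zero => simp
      | succ n ih => rw [pow_succ, mul_smul, ← add_assoc, hw, ih]
    -- The difference is zero modulo `𝔪` at level `0`, hence at every level by injectivity of `p ^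
    -- n` on the closed fibre. Its `n`-th term is `p ^ N` times its `(n + N)`-th, so it is zero.
    have h₀ : VanishesMod ((y - y') 0) := fun z a => by
      rw [Pi.sub_apply, map_sub, h₂, h₂', sub_self]
    have hn (n : ℕ) : VanishesMod ((y - y') n) := by
      refine vanishesMod_of_pow_smul e (p := p) (n := n) (h ≫ t) ?_
      have := hw' n 0
      rw [zero_add] at this
      rwa [this]
    rw [← sub_eq_zero]
    funext n
    rw [← hw' N n, pow_smul_eq_zero_of_vanishesMod e p hN (hn _)]
    rfl
  · intro D g hg h x
    have := perfectRing_redRing g p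
    have hb := fun n => bijective_pow_smul_torus e (redIncl g ≫ h ≫ t) hp n
    choose τ hτ using fun n => (hb n).2 (ev₀ u₀ (redk g) (res L (redIncl g) x))
    choose σ hσ using fun n => exists_lift_torus e (h ≫ t) hN (τ n)
    have hτ' (n : ℕ) : p • τ (n + 1) = τ n := by
      apply (hb n).1
      beta_reduce
      rw [smul_smul, ← pow_succ]
      exact (hτ (n + 1)).trans (hτ n).symm
    -- The lifts `σ` are compatible only modulo `𝔪`; the factor `p ^ N` makes them exactly
    -- compatible. The shift by `N` compensates it: at level `0` the reduction is `p ^ N • τ N`, the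
    -- value of `u₀`.
    refine ⟨fun n => p ^ N • σ (n + N), fun n => ?_, fun z a => ?_⟩
    · rw [smul_comm, ← sub_eq_zero, ← smul_sub]
      apply pow_smul_eq_zero_of_vanishesMod e p hN
      rw [vanishesMod_iff, map_sub, map_nsmul, hσ, hσ, add_right_comm, hτ', sub_self]
    · obtain ⟨b, rfl⟩ := exists_red_factor z a
      have hred : res T (redIncl g) (p ^ N • σ (0 + N)) =
          ev₀ u₀ (redk g) (res L (redIncl g) x) := by
        rw [map_nsmul, hσ, zero_add]
        exact hτ N
      refine (res_res T (redIncl g) ((Over.map (closedPt R)).map b) _).symm.trans ?_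
      rw [hred]
      refine (ev₀_res u₀ b _).symm.trans ?_
      exact congrArg (ev₀ u₀ z) (res_res L _ _ _)

end Splitting

/-! ### Dividing points in the extension; Frobenius descent over perfect rings -/

section Extension

variable {S : Scheme.{u}} {p : ℕ} {T L B : FppfAb S} {i : pTorsion p T ⟶ B}
  {q : B ⟶ latticeBT p L} {w : i ≫ q = 0}

/-- Points of an extension with the same image differ by a point of the subgroup. -/
theorem exists_sub_eq (hE : (ShortComplex.mk i q w).ShortExact) {X : Over S} {b b' : Sec B X}
    (h : ev q X b = ev q X b') : ∃ t : Sec (pTorsion p T) X, ev i X t = b - b' := by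
  have : Mono i := hE.mono_f
  exact exists_sec_of_exact i q w hE.exact X (b - b') (by rw [map_sub, h, sub_self])

theorem ev_w (w : i ≫ q = 0) {X : Over S} (t : Sec (pTorsion p T) X) :
    ev q X (ev i X t) = 0 := by
  rw [← ev_comp, w, ev_zero]

/-- The points of `T[p^∞]` are the points of `T` which are killed by a power of `p`. -/
theorem exists_pTorsion_sec {X : Over S} {n : ℕ} {x : Sec T X} (hx : p ^ n • x = 0) :
    ∃ t : Sec (pTorsion p T) X, ev (pTorsionι p T) X t = x ∧ p ^ n • t = 0 := by
  have hw : torsionι T (p ^ n) ≫ ((p ^ n) • 𝟙 T) = 0 := kernel.condition _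
  obtain ⟨t, ht⟩ := exists_sec_of_exact (torsionι T (p ^ n)) ((p ^ n) • 𝟙 T) hw
    (ShortComplex.exact_of_f_is_kernel _ (kernelIsKernel ((p ^ n) • 𝟙 T))) X x
    (by rw [ev_nsmul, ev_id, hx])
  have ht' : ev (pTorsionι p T) X (ev (toPTorsion p T n) X t) = x := by
    rw [← ev_comp, toPTorsion_ι, ht]
  refine ⟨_, ht', ev_injective (pTorsionι p T) X ?_⟩
  rw [map_nsmul, ht', hx, map_zero]

/-- The points `x / p^n` of `L[p^∞]` lift locally to points which are killed by `p^n`. -/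
theorem exists_local_div [Epi (p • 𝟙 T)] (hE : (ShortComplex.mk i q w).ShortExact) {X : Over S}
    (x : Sec L X) (n : ℕ) : ∃ s ∈ topo S X, ∀ (Y : Over S) (k : Y ⟶ X), s k →
      ∃ b : Sec B Y, ev q Y b = ev (divPow p L n) Y (res L k x) ∧ p ^ n • b = 0 := by
  have : Epi q := hE.epi_g
  let s : Sieve X :=
    { arrows := fun Y k => ∃ b : Sec B Y, ev q Y b = ev (divPow p L n) Y (res L k x) ∧
        p ^ n • b = 0
      downward_closed := by
        rintro Y Z k ⟨b, hb, hb'⟩ l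
        refine ⟨res B l b, ?_, by rw [← map_nsmul, hb', map_zero]⟩
        rw [ev_res, hb, ← ev_res, res_res] }
  obtain ⟨s₁, hs₁, H₁⟩ := exists_local_lift q X (ev (divPow p L n) X x)
  refine ⟨s, (topo S).transitive hs₁ s ?_, fun Y k hk => hk⟩
  intro Y k hk
  obtain ⟨b, hb⟩ := H₁ Y k hk
  -- `p ^ n • b` lies over zero, so it comes from `T[p^∞]`, which is `p`-divisible; subtracting a
  -- local `p ^ n`-th root makes `b` torsion.
  obtain ⟨t, ht⟩ := exists_sub_eq hE (b := p ^ n • b) (b' := 0) (by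
    rw [map_nsmul, hb, ← ev_res, ← ev_nsmul, pow_smul_divPow, ev_zero, map_zero])
  have := epi_pow_smul (pTorsion p T) p n
  obtain ⟨s₂, hs₂, H₂⟩ := exists_local_lift ((p ^ n) • 𝟙 (pTorsion p T)) Y t
  refine (topo S).superset_covering ?_ hs₂
  intro Z l hl
  obtain ⟨t', ht'⟩ := H₂ Z l hl
  rw [ev_nsmul, ev_id] at ht'
  refine ⟨res B l b - ev i Z t', ?_, ?_⟩
  · rw [map_sub, ev_res, hb, ev_w w, sub_zero, ← ev_res, ← ev_res, res_res]
  · rw [smul_sub, ← map_nsmul, ← map_nsmul, ht', ev_res, ht, sub_zero, sub_self]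

/-- Sieves on affine schemes do not depend on the structure morphism. -/
theorem exists_sieve_of_left {C : CommRingCat.{u}} (g g' : Spec C ⟶ S) (s : Sieve (aff g'))
    (hs : s ∈ topo S (aff g')) : ∃ t ∈ topo S (aff g), ∀ {Y : Over S} (k : Y ⟶ aff g),
      t k → s (Over.homMk k.left : Over.mk (k.left ≫ g') ⟶ aff g') := by
  refine ⟨(Sieve.overEquiv (aff g)).symm (Sieve.overEquiv (aff g') s), ?_, ?_⟩
  · rw [GrothendieckTopology.mem_over_iff]
    refine (congrArg (· ∈ Scheme.fppfTopology (Spec C))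
      ((Sieve.overEquiv (aff g)).apply_symm_apply (Sieve.overEquiv (aff g') s))).mpr ?_
    exact (GrothendieckTopology.mem_over_iff _ _).1 hs
  · intro Y k hk
    exact (Sieve.overEquiv_iff _ _).1 ((Sieve.overEquiv_symm_iff _ _).1 hk)

theorem exists_iterate_frobenius (C : Type*) [CommRing C] {p : ℕ} (hp : p.Prime) (hC : (p : C) = 0)
    (n : ℕ) : ∃ φ : C →+* C, ∀ x, φ x = x ^ p ^ n := by
  rcases subsingleton_or_nontrivial C with h | h
  · exact ⟨RingHom.id C, fun x => Subsingleton.elim _ _⟩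
  · have : CharP C p := (CharP.charP_iff_prime_eq_zero hp).2 hC
    have := Fact.mk hp
    exact ⟨iterateFrobenius C p n, fun x => iterateFrobenius_def p n x⟩

variable {U : Scheme.{u}} {f : U ⟶ S} {d : ℕ}

/-- Over perfect schemes the points `x / p^n` of `L[p^∞]` lift to points killed by `p^n`. -/
theorem exists_div_of_perfect [Epi (p • 𝟙 T)] (hE : (ShortComplex.mk i q w).ShortExact)
    (e : (baseChange f).obj T ≅ splitTorus U d) (hp : p.Prime) {C : CommRingCat.{u}}
    (g : Spec C ⟶ S) (h : aff g ⟶ Over.mk f) [PerfectRing C p] (hC : (p : C) = 0)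
    (x : Sec L (aff g)) (n : ℕ) :
    ∃ b : Sec B (aff g), ev q _ b = ev (divPow p L n) _ x ∧ p ^ n • b = 0 := by
  obtain ⟨F, hF⟩ := exists_iterate_frobenius C hp hC n
  let E : C ≃+* C := RingEquiv.ofBijective F (by
    rw [show (F : C → C) = fun x => x ^ p ^ n from funext hF]
    exact (PerfectRing.pow C p n).bijective_frobenius)
  -- `θ` is the inverse of the `n`-fold Frobenius of the perfect ring `C`. The section `x` is first
  -- pulled back along `θ`, divided locally there, and then pulled back along Frobenius, which
  -- returns to `x`.
  let θ : Spec C ⟶ Spec C := Spec.map (CommRingCat.ofHom E.symm.toRingHom)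
  have hθ : Spec.map (CommRingCat.ofHom F) ≫ θ = 𝟙 _ := by
    rw [← Spec.map_comp, ← Spec.map_id]
    congr 1
    ext x
    exact E.apply_symm_apply x
  have hD {D : CommRingCat.{u}} (χ : Spec D ⟶ Spec C) : (p : D) = 0 := by
    have := congrArg (Spec.preimage χ).hom hC
    rwa [map_natCast, map_zero] at this
  have hcomm {D D' : CommRingCat.{u}} (χ : Spec D ⟶ Spec D') (φ : D ⟶ D) (φ' : D' ⟶ D')
      (hφ : ∀ x, φ.hom x = x ^ p ^ n) (hφ' : ∀ x, φ'.hom x = x ^ p ^ n) :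
      Spec.map φ ≫ χ = χ ≫ Spec.map φ' := by
    rw [← Spec.map_preimage χ, ← Spec.map_comp, ← Spec.map_comp]
    congr 1
    ext x
    change φ.hom ((Spec.preimage χ).hom x) = (Spec.preimage χ).hom (φ'.hom x)
    rw [hφ, hφ', map_pow]
  have hcommθ {D : CommRingCat.{u}} (χ : Spec D ⟶ Spec C) (φ : D ⟶ D)
      (hφ : ∀ x, φ.hom x = x ^ p ^ n) : Spec.map φ ≫ χ ≫ θ = χ := by
    rw [← Category.assoc, hcomm χ φ (CommRingCat.ofHom F) hφ hF, Category.assoc, hθ]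
    exact Category.comp_id χ
  let m : aff (θ ≫ g) ⟶ aff g := Over.homMk θ
  let tw {D : CommRingCat.{u}} {c : Spec D ⟶ S} (k : aff c ⟶ aff g) : Over S :=
    aff (k.left ≫ θ ≫ g)
  let k' {D : CommRingCat.{u}} {c : Spec D ⟶ S} (k : aff c ⟶ aff g) : tw k ⟶ aff g :=
    Over.homMk (k.left ≫ θ) (Category.assoc _ _ _)
  -- `tw k` is `Spec D` with its structure morphism twisted by `θ`, and `κ` is the `n`-fold
  -- Frobenius of `D`, a morphism over `S` for this twist even if `D` is not perfect. `Q` selects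
  -- the Frobenius pullbacks of torsion lifts.
  let Q : ∀ {D : CommRingCat.{u}} {c : Spec D ⟶ S}, (aff c ⟶ aff g) → Sec B (aff c) → Prop :=
    fun {D c} k y => ∃ (κ : aff c ⟶ tw k) (φ : D ⟶ D) (_ : κ.left = Spec.map φ)
      (_ : ∀ x, φ.hom x = x ^ p ^ n) (b : Sec B (tw k)),
      ev q _ b = ev (divPow p L n) _ (res L (k' k) x) ∧ p ^ n • b = 0 ∧ y = res B κ b
  have hκ {D : CommRingCat.{u}} {c : Spec D ⟶ S} (k : aff c ⟶ aff g) (κ : aff c ⟶ tw k)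
      (φ : D ⟶ D) (h₁ : κ.left = Spec.map φ) (hφ : ∀ x, φ.hom x = x ^ p ^ n) : κ ≫ k' k = k := by
    ext : 1
    change κ.left ≫ k.left ≫ θ = k.left
    rw [h₁]
    exact hcommθ k.left φ hφ
  have hex {D : CommRingCat.{u}} {c : Spec D ⟶ S} (k : aff c ⟶ aff g) (b : Sec B (tw k))
      (hb : ev q _ b = ev (divPow p L n) _ (res L (k' k) x)) (hb' : p ^ n • b = 0) :
      ∃ y, Q k y := by
    obtain ⟨φ, hφ⟩ := exists_iterate_frobenius D hp (hD k.left) n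
    refine ⟨_, Over.homMk (Spec.map (CommRingCat.ofHom φ)) ?_, CommRingCat.ofHom φ, rfl, hφ, b,
      hb, hb', rfl⟩
    change Spec.map _ ≫ k.left ≫ θ ≫ g = c
    have h₁ := hcommθ k.left (CommRingCat.ofHom φ) hφ
    have h₂ : k.left ≫ g = c := Over.w k
    rw [reassoc_of% h₁, h₂]
  have hQ {D : CommRingCat.{u}} {c : Spec D ⟶ S} (k : aff c ⟶ aff g) (y : Sec B (aff c))
      (hy : Q k y) : ev q _ y = ev (divPow p L n) _ (res L k x) ∧ p ^ n • y = 0 := by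
    obtain ⟨κ, φ, hφ, hφ', b, hb, hb', rfl⟩ := hy
    refine ⟨?_, by rw [← map_nsmul, hb', map_zero]⟩
    rw [ev_res, hb, ← ev_res, res_res, hκ k κ φ hφ hφ']
  obtain ⟨s, hs, H⟩ := exists_local_div hE x n
  obtain ⟨t, ht, H'⟩ := exists_sieve_of_left g (θ ≫ g) (s.pullback m)
    ((topo S).pullback_stable m hs)
  have hext {D : CommRingCat.{u}} {c : Spec D ⟶ S} (k : aff c ⟶ aff g) (hk : t k) :
      ∃ y, Q k y := by
    have h₁ : s (k' k) := by
      have : k' k = (Over.homMk k.left : Over.mk (k.left ≫ θ ≫ g) ⟶ aff (θ ≫ g)) ≫ m := rfl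
      rw [this]
      exact H' k hk
    obtain ⟨b, hb, hb'⟩ := H _ _ h₁
    exact hex k b hb hb'
  have hres : ∀ {D D' : CommRingCat.{u}} {c : Spec D ⟶ S} {c' : Spec D' ⟶ S} (k : aff c ⟶ aff g)
      (l : aff c' ⟶ aff c) (y : Sec B (aff c)), Q k y → Q (l ≫ k) (res B l y) := by
    rintro D D' c c' k l _ ⟨κ, φ, hφ, hφ', b, hb, hb', rfl⟩
    obtain ⟨ψ, hψ⟩ := exists_iterate_frobenius D' hp (hD (l ≫ k).left) n
    let l' : tw (l ≫ k) ⟶ tw k := Over.homMk l.left (Category.assoc _ _ _).symm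
    let κ' : aff c' ⟶ tw (l ≫ k) := Over.homMk (Spec.map (CommRingCat.ofHom ψ)) (by
      change Spec.map _ ≫ (l ≫ k).left ≫ θ ≫ g = c'
      have h₁ := hcommθ (l ≫ k).left (CommRingCat.ofHom ψ) hψ
      have h₂ : (l ≫ k).left ≫ g = c' := Over.w (l ≫ k)
      rw [reassoc_of% h₁, h₂])
    have hl' : l' ≫ k' k = k' (l ≫ k) := by
      ext : 1
      exact (Category.assoc l.left k.left θ).symm
    have hκ' : κ' ≫ l' = l ≫ κ := by
      ext : 1
      change Spec.map _ ≫ l.left = l.left ≫ κ.left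
      rw [hφ]
      exact hcomm _ _ _ hψ hφ'
    refine ⟨κ', CommRingCat.ofHom ψ, rfl, hψ, res B l' b, ?_, ?_, ?_⟩
    · rw [ev_res, hb, ← ev_res, res_res, hl']
    · rw [← map_nsmul, hb', map_zero]
    · rw [res_res, res_res, hκ']
  have huniq : ∀ {D : CommRingCat.{u}} {c : Spec D ⟶ S} (k : aff c ⟶ aff g)
      (y y' : Sec B (aff c)), Q k y → Q k y' → y = y' := by
    rintro D c k _ _ ⟨κ, φ, hφ, hφ', b, hb, hb', rfl⟩ ⟨κ₁, φ₁, hφ₁, hφ₁', b₁, hb₁, hb₁', rfl⟩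
    have hφφ : φ = φ₁ := by
      ext x
      rw [hφ', hφ₁']
    have hκκ : κ = κ₁ := by
      ext : 1
      rw [hφ, hφ₁, hφφ]
    subst hκκ
    obtain ⟨τ, hτ⟩ := exists_sub_eq hE (hb.trans hb₁.symm)
    have : Mono i := hE.mono_f
    -- Two torsion lifts differ by a `p ^ n`-torsion point of the torus. Frobenius sends each
    -- coordinate of it to its `p ^ n`-th power, which is `1`, so the pullbacks agree.
    have hτ' : p ^ n • τ = 0 := by
      apply ev_injective i
      rw [map_nsmul, hτ, smul_sub, hb', hb₁', sub_zero, map_zero]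
    have hτ'' : res (pTorsion p T) κ τ = 0 := by
      apply ev_injective (pTorsionι p T)
      rw [ev_res, map_zero]
      refine res_frobenius_eq_zero e κ (k' k ≫ h) φ hφ hφ' _ ?_
      rw [← map_nsmul, hτ', map_zero]
    rw [← sub_eq_zero, ← map_sub, ← hτ, ← ev_res, hτ'', map_zero]
  obtain ⟨β, hβ⟩ := exists_glue_of_unique B (aff g) Q hres huniq ht hext
  refine ⟨β, sec_ext_aff _ ht fun D c k hk => ?_, sec_ext_aff _ ht fun D c k hk => ?_⟩
  · obtain ⟨y, hy⟩ := hext k hk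
    rw [← ev_res, ← ev_res, hβ k y hy, (hQ k y hy).1]
  · obtain ⟨y, hy⟩ := hext k hk
    rw [map_nsmul, hβ k y hy, (hQ k y hy).2, map_zero]

end Extension

/-! ### The canonical `p`-divisible family in the extension -/

section Rigidity

open IsLocalRing

variable {R : Type u} [CommRing R] [IsLocalRing R] {p : ℕ}
  {T L B : FppfAb (Spec (CommRingCat.of R))} {i : pTorsion p T ⟶ B}
  {q : B ⟶ latticeBT p L} {w : i ≫ q = 0} {U : Scheme.{u}}
  {f : U ⟶ Spec (CommRingCat.of R)} {d : ℕ}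

instance {C : CommRingCat.{u}} (g : Spec C ⟶ Spec (CommRingCat.of R)) : Mono (redIncl g) := by
  have : IsClosedImmersion (Spec.map (CommRingCat.ofHom (Ideal.Quotient.mk (redIdeal g)))) :=
    IsClosedImmersion.spec_of_surjective _ (by exact Ideal.Quotient.mk_surjective)
  have : Mono (redIncl g).left :=
    inferInstanceAs (Mono (Spec.map (CommRingCat.ofHom (Ideal.Quotient.mk (redIdeal g)))))
  exact Over.mono_of_mono_left _

theorem exists_comp_redIncl {C D : CommRingCat.{u}} {g : Spec C ⟶ Spec (CommRingCat.of R)}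
    (z : Spec D ⟶ Spec (CommRingCat.of (ResidueField R))) (a : aff (z ≫ closedPt R) ⟶ aff g) :
    ∃ b : aff (z ≫ closedPt R) ⟶ aff (redk g ≫ closedPt R), b ≫ redIncl g = a :=
  (exists_red_factor z a).elim fun b hb => ⟨(Over.map (closedPt R)).map b, hb⟩

variable [CharP (ResidueField R) p]

/-- Multiplication by a power of `p` identifies lifts of points of the closed fibre. -/
theorem pow_smul_eq_of_vanishesMod (hE : (ShortComplex.mk i q w).ShortExact)
    (e : (baseChange f).obj T ≅ splitTorus U d) [Flat f] [LocallyOfFinitePresentation f]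
    [Surjective f] {N : ℕ} (hN : maximalIdeal R ^ N = ⊥) {X : Over (Spec (CommRingCat.of R))}
    {b b' : Sec B X} (hq : ev q X b = ev q X b') (hb : VanishesMod (b - b')) :
    p ^ N • b = p ^ N • b' := by
  have : Mono i := hE.mono_f
  obtain ⟨t, ht⟩ := exists_sub_eq hE hq
  have h : VanishesMod (ev (pTorsionι p T) X t) := by
    refine VanishesMod.ev _ fun z a => ?_
    apply ev_injective i
    rw [ev_res, ht, hb z a, map_zero]
  have h' : p ^ N • t = 0 := by
    apply ev_injective (pTorsionι p T)
    rw [map_nsmul, pow_smul_eq_zero_of_vanishesMod e p hN h, map_zero]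
  rw [← sub_eq_zero, ← smul_sub, ← ht, ← map_nsmul, h', map_zero]

variable [Fact p.Prime] [PerfectField (ResidueField R)]

/-- The points `x / p^n` of `L[p^∞]` over the closed fibre of an étale scheme lift uniquely to a
`p`-divisible system of points killed by powers of `p`. -/
theorem exists_closed_family [Epi (p • 𝟙 T)] (hE : (ShortComplex.mk i q w).ShortExact)
    (e : (baseChange f).obj T ≅ splitTorus U d) {C : CommRingCat.{u}}
    {g : Spec C ⟶ Spec (CommRingCat.of R)} [Etale g] (h : aff g ⟶ Over.mk f)
    (x : Sec L (aff (redk g ≫ closedPt R))) :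
    ∃ β : ℕ → Sec B (aff (redk g ≫ closedPt R)), (∀ n, ev q _ (β n) = ev (divPow p L n) _ x) ∧
      (∀ n, p ^ n • β n = 0) ∧ ∀ n, p • β (n + 1) = β n := by
  have hp : p.Prime := Fact.out
  have := perfectRing_redRing g p
  have hC : (p : redRing g) = 0 := by
    have := Ideal.Quotient.eq_zero_iff_mem.2 (natCast_mem_redIdeal (g := g) p)
    rwa [map_natCast] at this
  choose β hβ hβ' using exists_div_of_perfect hE e hp (redk g ≫ closedPt R) (redIncl g ≫ h) hC x
  refine ⟨β, hβ, hβ', fun n => ?_⟩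
  obtain ⟨t, ht⟩ := exists_sub_eq hE (b := p • β (n + 1)) (b' := β n) (by
    rw [map_nsmul, hβ, hβ, ← ev_nsmul, smul_divPow_succ])
  have : Mono i := hE.mono_f
  -- The discrepancy is a `p ^ n`-torsion point of the torus over a perfect ring, where there are no
  -- nonzero ones.
  have ht' : p ^ n • t = 0 := by
    apply ev_injective i
    rw [map_nsmul, ht, smul_sub, smul_smul, ← pow_succ, hβ', hβ', sub_zero, map_zero]
  have ht'' : t = 0 := by
    apply ev_injective (pTorsionι p T)
    apply (bijective_pow_smul_torus e (redIncl g ≫ h) hp.ne_zero n).1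
    beta_reduce
    rw [← map_nsmul, ht', map_zero, smul_zero]
  rw [← sub_eq_zero, ← ht, ht'', map_zero]

/-- The points `x / p^n` of `L[p^∞]` over étale schemes lift to `p`-divisible systems of points
killed by powers of `p`. -/
theorem exists_div_family [Epi (p • 𝟙 T)] (hE : (ShortComplex.mk i q w).ShortExact)
    (e : (baseChange f).obj T ≅ splitTorus U d) [Flat f] [LocallyOfFinitePresentation f]
    [Surjective f] {N : ℕ} (hN : maximalIdeal R ^ N = ⊥) {C : CommRingCat.{u}}
    {g : Spec C ⟶ Spec (CommRingCat.of R)} [Etale g] (h : aff g ⟶ Over.mk f)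
    (x : Sec L (aff g)) : ∃ y : ℕ → Sec B (aff g), (∀ n, p • y (n + 1) = y n) ∧
      (∀ n, ev q _ (y n) = ev (divPow p L n) _ x) ∧ ∀ n, p ^ (n + N) • y n = 0 := by
  have : Mono i := hE.mono_f
  obtain ⟨β, hβ, hβ', hβs⟩ := exists_closed_family hE e h (res L (redIncl g) x)
  let Red (m : ℕ) {D : CommRingCat.{u}} {c : Spec D ⟶ Spec (CommRingCat.of R)}
      (k : aff c ⟶ aff g) (b : Sec B (aff c)) : Prop :=
    ∀ {D' : CommRingCat.{u}} (z : Spec D' ⟶ Spec (CommRingCat.of (ResidueField R)))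
      (a : aff (z ≫ closedPt R) ⟶ aff c)
      (a₀ : aff (z ≫ closedPt R) ⟶ aff (redk g ≫ closedPt R)),
      a ≫ k = a₀ ≫ redIncl g → res B a b = res B a₀ (β m)
  -- As for the torus: `p ^ N` times any lift `b` of `x / p ^ (n + N)` with prescribed reduction `β
  -- (n + N)`. Two choices of `b` differ by a torus point vanishing modulo `𝔪`, so the multiple is
  -- unique.
  let Q (n : ℕ) : ∀ {D : CommRingCat.{u}} {c : Spec D ⟶ Spec (CommRingCat.of R)},
      (aff c ⟶ aff g) → Sec B (aff c) → Prop := fun {D c} k y => ∃ b : Sec B (aff c),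
    ev q _ b = ev (divPow p L (n + N)) _ (res L k x) ∧ p ^ (n + N + N) • b = 0 ∧
      Red (n + N) k b ∧ y = p ^ N • b
  have hres (n : ℕ) : ∀ {D D' : CommRingCat.{u}} {c : Spec D ⟶ Spec (CommRingCat.of R)}
      {c' : Spec D' ⟶ Spec (CommRingCat.of R)} (k : aff c ⟶ aff g) (l : aff c' ⟶ aff c)
      (y : Sec B (aff c)), Q n k y → Q n (l ≫ k) (res B l y) := by
    rintro D D' c c' k l _ ⟨b, hb, hb', hr, rfl⟩
    refine ⟨res B l b, ?_, ?_, fun z a a₀ ha => ?_, by rw [map_nsmul]⟩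
    · rw [ev_res, hb, ← ev_res, res_res]
    · rw [← map_nsmul, hb', map_zero]
    · rw [res_res]
      exact hr z (a ≫ l) a₀ (by rw [Category.assoc, ha])
  have huniq (n : ℕ) : ∀ {D : CommRingCat.{u}} {c : Spec D ⟶ Spec (CommRingCat.of R)}
      (k : aff c ⟶ aff g) (y y' : Sec B (aff c)), Q n k y → Q n k y' → y = y' := by
    rintro D c k _ _ ⟨b, hb, hb', hr, rfl⟩ ⟨b₁, hb₁, hb₁', hr₁, rfl⟩
    refine pow_smul_eq_of_vanishesMod hE e hN (hb.trans hb₁.symm) fun z a => ?_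
    obtain ⟨a₁, ha₁⟩ := exists_comp_redIncl z (a ≫ k)
    rw [map_sub, hr z a _ ha₁.symm, hr₁ z a _ ha₁.symm, sub_self]
  choose s hs H using fun n => exists_local_div hE x (n + N)
  have hex (n : ℕ) {D : CommRingCat.{u}} {c : Spec D ⟶ Spec (CommRingCat.of R)}
      (k : aff c ⟶ aff g) (hk : s n k) : ∃ y, Q n k y := by
    obtain ⟨b, hb, hb'⟩ := H n _ k hk
    obtain ⟨k₀, hk₀⟩ := exists_comp_redIncl (redk c) (redIncl c ≫ k)
    -- A local lift `b` need not reduce to `β (n + N)`. The error `t₀` is a torsion torus point of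
    -- the closed fibre; it is lifted to the torus and subtracted from `b`.
    obtain ⟨t₀, ht₀⟩ := exists_sub_eq hE (b := res B (redIncl c) b)
      (b' := res B k₀ (β (n + N))) (by
        rw [ev_res, hb, ← ev_res, res_res, ← hk₀, ev_res q, hβ, ← ev_res, res_res])
    have ht₀' : p ^ (n + N) • t₀ = 0 := by
      apply ev_injective i
      rw [map_nsmul, ht₀, smul_sub, ← map_nsmul, ← map_nsmul, hb', hβ', map_zero, map_zero, sub_zero,
        map_zero]
    obtain ⟨τ, hτ⟩ := exists_lift_torus e (k ≫ h) hN (ev (pTorsionι p T) _ t₀)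
    -- `p ^ (n + N)` kills the error only modulo `𝔪`; the second `N` kills what remains, whence the
    -- exponent in `Q`.
    have hτ' : p ^ (n + N + N) • τ = 0 := by
      rw [pow_add p (n + N) N, mul_comm, mul_smul]
      refine pow_smul_eq_zero_of_vanishesMod e p hN ?_
      rw [vanishesMod_iff, map_nsmul, hτ, ← map_nsmul, ht₀', map_zero]
    obtain ⟨t, ht, ht'⟩ := exists_pTorsion_sec hτ'
    have htt : res (pTorsion p T) (redIncl c) t = t₀ := by
      apply ev_injective (pTorsionι p T)
      rw [ev_res, ht, hτ]
    refine ⟨_, b - ev i _ t, ?_, ?_, fun {D'} z a a₀ ha => ?_, rfl⟩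
    · rw [map_sub, hb, ev_w w, sub_zero]
    · rw [smul_sub, ← map_nsmul, ht', map_zero, sub_zero, pow_add p (n + N) N, mul_comm, mul_smul,
        hb', smul_zero]
    · obtain ⟨a₁, rfl⟩ := exists_comp_redIncl z a
      have ha₀ : a₀ = a₁ ≫ k₀ := by
        rw [← cancel_mono (redIncl g), ← ha, Category.assoc, Category.assoc, hk₀]
      have hred : res B (redIncl c) (b - ev i _ t) =
          res B k₀ (β (n + N)) := by
        rw [map_sub, ← ev_res, htt, ht₀, sub_sub_cancel]
      rw [← res_res, hred, ha₀, res_res]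
  choose y hy using fun n => exists_glue_of_unique B (aff g) (Q n) (hres n) (huniq n) (hs n) (hex n)
  refine ⟨y, fun n => ?_, fun n => ?_, fun n => ?_⟩
  · refine sec_ext_aff B ((topo _).intersection_covering (hs n) (hs (n + 1))) fun D c k hk => ?_
    obtain ⟨z, hz⟩ := hex (n + 1) k hk.2
    rw [map_nsmul, hy (n + 1) k z hz]
    refine (hy n k _ ?_).symm
    obtain ⟨b, hb, hb', hr, rfl⟩ := hz
    have hn : n + 1 + N = n + N + 1 := add_right_comm n 1 N
    refine ⟨p • b, ?_, ?_, fun z a a₀ ha => ?_, smul_comm _ _ _⟩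
    · rw [map_nsmul, hb, hn, ← ev_nsmul, smul_divPow_succ]
    · rw [smul_smul, ← pow_succ, ← hb', hn, add_right_comm]
    · rw [map_nsmul, hr z a a₀ ha, ← map_nsmul, hn, hβs]
  · refine sec_ext_aff _ (hs n) fun D c k hk => ?_
    obtain ⟨z, hz⟩ := hex n k hk
    rw [← ev_res, hy n k z hz, ← ev_res]
    obtain ⟨b, hb, -, -, rfl⟩ := hz
    rw [map_nsmul, hb, ← ev_nsmul, pow_smul_family (smul_divPow_succ p L)]
  · refine sec_ext_aff _ (hs n) fun D c k hk => ?_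
    obtain ⟨z, hz⟩ := hex n k hk
    rw [map_nsmul, hy n k z hz]
    obtain ⟨b, -, hb, -, rfl⟩ := hz
    rw [smul_smul, ← pow_add, hb, map_zero]

/-- An extension of `L[p^∞]` by `T[p^∞]` receives a `p`-divisible system of homomorphisms from
`L` which lifts the canonical one. -/
theorem exists_family_extension [Epi (p • 𝟙 T)] (hE : (ShortComplex.mk i q w).ShortExact)
    (e : (baseChange f).obj T ≅ splitTorus U d) [Flat f] [LocallyOfFinitePresentation f]
    [Surjective f] {N : ℕ} (hN : maximalIdeal R ^ N = ⊥) {C : CommRingCat.{u}}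
    {v : Spec C ⟶ Spec (CommRingCat.of R)} [Etale v] [Surjective v] (t : aff v ⟶ Over.mk f)
    {A : Type} [AddCommGroup A] {ℓ : A →+ Sec L (aff v)} (hℓ : IsGenerating ℓ) :
    ∃ σ : ℕ → (L ⟶ B), (∀ n, p • σ (n + 1) = σ n) ∧ (∀ n, σ n ≫ q = divPow p L n) ∧
      p ^ N • σ 0 = 0 := by
  have : Mono i := hE.mono_f
  let P (X : Over (Spec (CommRingCat.of R))) (x : Sec L X) (y : ℕ → Sec B X) : Prop :=
    (∀ n, p • y (n + 1) = y n) ∧ (∀ n, ev q _ (y n) = ev (divPow p L n) _ x) ∧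
      ∀ n, p ^ (n + N) • y n = 0
  suffices key : ∃ σ : ℕ → (L ⟶ B), ∀ X x, P X x (fun n => ev (σ n) X x) by
    obtain ⟨σ, hσ⟩ := key
    refine ⟨σ, fun n => hom_ext_sec fun X x => ?_, fun n => hom_ext_sec fun X x => ?_,
      hom_ext_sec fun X x => ?_⟩
    · rw [ev_nsmul]
      exact (hσ X x).1 n
    · exact (hσ X x).2.1 n
    · have h := (hσ X x).2.2 0
      rw [zero_add] at h
      rw [ev_nsmul]
      exact h
  refine hℓ.exists_hom_of_unique P ?_ ?_ ?_ ?_ ?_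
  · rintro X Y k x y ⟨h₁, h₂, h₃⟩
    refine ⟨fun n => ?_, fun n => ?_, fun n => ?_⟩
    · rw [← map_nsmul, h₁]
    · rw [ev_res, ev_res, h₂]
    · rw [← map_nsmul, h₃, map_zero]
  · rintro X x x' y y' ⟨h₁, h₂, h₃⟩ ⟨h₁', h₂', h₃'⟩
    refine ⟨fun n => ?_, fun n => ?_, fun n => ?_⟩
    · rw [Pi.add_apply, smul_add, h₁, h₁', Pi.add_apply]
    · rw [Pi.add_apply, map_add, h₂, h₂', map_add]
    · rw [Pi.add_apply, smul_add, h₃, h₃', add_zero]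
  · intro X x y s hs H
    refine ⟨fun n => sec_ext _ hs fun Y k hk => ?_, fun n => sec_ext _ hs fun Y k hk => ?_,
      fun n => sec_ext _ hs fun Y k hk => ?_⟩
    · rw [map_nsmul]
      exact (H k hk).1 n
    · rw [← ev_res, ← ev_res]
      exact (H k hk).2.1 n
    · rw [map_nsmul, map_zero]
      exact (H k hk).2.2 n
  · rintro D g hg h x y y' ⟨h₁, h₂, h₃⟩ ⟨h₁', h₂', h₃'⟩
    choose τ hτ using fun n => exists_sub_eq hE ((h₂ n).trans (h₂' n).symm)
    have hτs (n : ℕ) : p • τ (n + 1) = τ n := by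
      apply ev_injective i
      rw [map_nsmul, hτ, hτ, smul_sub, h₁, h₁']
    have hτs' (n m : ℕ) : p ^ n • τ (m + n) = τ m := by
      induction n with
      | zero => simp
      | succ n ih => rw [pow_succ, mul_smul, ← add_assoc, hτs, ih]
    have hτ₀ (n : ℕ) : p ^ (n + N) • τ n = 0 := by
      apply ev_injective i
      rw [map_nsmul, hτ, smul_sub, h₃, h₃', sub_zero, map_zero]
    -- The torsion bound in `P` serves uniqueness: the difference of two solutions is a `p`-power
    -- torsion point, so it vanishes on the perfect closed fibre, and `p`-divisibility of the family
    -- then makes it zero.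
    have hv (n : ℕ) : VanishesMod (ev (pTorsionι p T) _ (τ n)) := by
      refine vanishesMod_of_pow_smul e (p := p) (n := n + N) (h ≫ t) fun z a => ?_
      rw [← map_nsmul, hτ₀, map_zero, map_zero]
    funext n
    have hn : τ n = 0 := by
      apply ev_injective (pTorsionι p T)
      rw [← hτs' N n, map_nsmul, pow_smul_eq_zero_of_vanishesMod e p hN (hv _), map_zero]
    rw [← sub_eq_zero, ← hτ, hn, map_zero]
  · intro D g hg h x
    exact exists_div_family hE e hN (h ≫ t) x

end Rigidity

/-! ### Equality of homomorphisms modulo `𝔪` -/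

section Lifting

open IsLocalRing

variable {R : Type u} [CommRing R] [IsLocalRing R] {T L : FppfAb (Spec (CommRingCat.of R))}

theorem vanishesMod_sub_of_baseChange {φ ψ : L ⟶ T}
    (h : (baseChange (closedPt R)).map φ = (baseChange (closedPt R)).map ψ)
    {X : Over (Spec (CommRingCat.of R))} (x : Sec L X) : VanishesMod (ev (φ - ψ) X x) := by
  intro D z a
  rw [← ev_res, ev_sub, sub_eq_zero]
  exact congrArg (fun χ => ev₀ χ z (res L a x)) h

theorem baseChange_map_eq_of_vanishesMod {φ ψ : L ⟶ T}
    (h : ∀ (X : Over (Spec (CommRingCat.of R))) (x : Sec L X), VanishesMod (ev (φ - ψ) X x)) :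
    (baseChange (closedPt R)).map φ = (baseChange (closedPt R)).map ψ := by
  apply hom_ext_sec
  intro Z x
  apply sec_ext_aff _ ((topo _).top_mem Z)
  intro D z k _
  have h' : ∀ (X : Over (Spec (CommRingCat.of R))) (x : Sec L X) (a : aff (z ≫ closedPt R) ⟶ X),
      res T a (ev φ X x) = res T a (ev ψ X x) := by
    intro X x a
    rw [← sub_eq_zero, ← map_sub, ← ev_sub]
    exact h X x z a
  exact h' _ x ((Over.map (closedPt R)).map k)

/-- Whether a morphism is zero over the residue field can be checked on generators. -/
theorem IsGenerating.vanishesMod {V : Over (Spec (CommRingCat.of R))} [Flat V.hom]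
    [LocallyOfFinitePresentation V.hom] [Surjective V.hom] {A : Type} [AddCommGroup A]
    {ℓ : A →+ Sec L V} (hℓ : IsGenerating ℓ) {φ : L ⟶ T}
    (h : ∀ a, VanishesMod (ev φ V (ℓ a))) {X : Over (Spec (CommRingCat.of R))} (x : Sec L X) :
    VanishesMod (ev φ X x) := by
  intro D z a
  obtain ⟨s, hs, H⟩ := hℓ.exists_cover (res L a x)
  apply sec_ext_closed T hs
  intro D' z' b hb
  obtain ⟨j, c, hc⟩ := H _ hb
  rw [map_zero, ← ev_res]
  refine (ev_res φ ((Over.map (closedPt R)).map b) (res L a x)).symm.trans ?_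
  rw [hc, ev_res]
  exact h c z' j

end Lifting

end OneMotive

end

/-! ### Existence and uniqueness of the lift -/

open OneMotive
theorem mainTheorem6 {R : Type u} [CommRing R] [IsLocalRing R] [IsArtinianRing R]
    (p : ℕ) [Fact p.Prime] [CharP (IsLocalRing.ResidueField R) p]
    [PerfectField (IsLocalRing.ResidueField R)]
    (T L : FppfAb (Spec (CommRingCat.of R))) (hT : IsTorus T) (hL : IsLattice L)
    (u₀ : (baseChange (Spec.map (CommRingCat.ofHom (IsLocalRing.residue R)))).obj L ⟶
      (baseChange (Spec.map (CommRingCat.ofHom (IsLocalRing.residue R)))).obj T)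
    (B : FppfAb (Spec (CommRingCat.of R))) (hB : IsBTGroup p B)
    (i : pTorsion p T ⟶ B) (q : B ⟶ latticeBT p L) (w : i ≫ q = 0)
    (hE : (ShortComplex.mk i q w).ShortExact) :
    ∃! v : L ⟶ T,
      (baseChange (Spec.map (CommRingCat.ofHom (IsLocalRing.residue R)))).map v = u₀ ∧
        BTIsoAsExtension p v i q := by
  have hp : p ≠ 0 := (Fact.out : p.Prime).ne_zero
  obtain ⟨N, hN⟩ : ∃ N, IsLocalRing.maximalIdeal R ^ N = ⊥ := by
    have h := IsArtinianRing.isNilpotent_jacobson_bot (R := R)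
    rwa [IsLocalRing.jacobson_eq_maximalIdeal ⊥ bot_ne_top] at h
  obtain ⟨U, f, _, _, d, e, C, v, _, _, t, r, ℓ, hℓ⟩ := exists_splitting hT hL
  have : Flat (aff v).hom := inferInstanceAs (Flat v)
  have : LocallyOfFinitePresentation (aff v).hom :=
    inferInstanceAs (LocallyOfFinitePresentation v)
  have : Surjective (aff v).hom := inferInstanceAs (Surjective v)
  have : Mono (p • 𝟙 L) := hℓ.mono_smul hp
  have : Epi (p • 𝟙 T) := epi_smul_torus e hp
  have : Mono i := hE.mono_f
  obtain ⟨φ, hφ, hφ₀⟩ := exists_family_torus e p hN t hℓ u₀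
  obtain ⟨σ, hσ, hσq, hσN⟩ := exists_family_extension hE e hN t hℓ
  have hq : σ 0 ≫ q = 0 := by
    rw [hσq]
    simpa using pow_smul_divPow p L 0
  -- `σ 0` lies over `x ↦ x / p ^ 0 = 0`, so it factors through `T[p^∞]`.
  let τ : L ⟶ pTorsion p T := hE.exact.lift (σ 0) hq
  have hτ : τ ≫ i = σ 0 := hE.exact.lift_f (σ 0) hq
  have hd : p ^ N • (τ ≫ pTorsionι p T) = 0 := by
    have h : p ^ N • τ = 0 := by
      rw [← cancel_mono i, Preadditive.nsmul_comp, hτ, hσN, zero_comp]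
    rw [← Preadditive.nsmul_comp, h, zero_comp]
  have hd' : torsLift p N (τ ≫ pTorsionι p T) hd ≫ i = σ 0 := by
    have h : torsLift p N (τ ≫ pTorsionι p T) hd = τ := by
      rw [← cancel_mono (pTorsionι p T), torsLift_ι]
    rw [h, hτ]
  have hv {ψ : L ⟶ T} (h : ∀ a, VanishesMod (ev (p ^ N • ψ) (aff v) (ℓ a))) (a : Fin r → ℤ) :
      VanishesMod (ev ψ (aff v) (ℓ a)) :=
    vanishesMod_of_pow_smul e (p := p) (n := N) t (by rw [← ev_nsmul]; exact h a)
  -- The correction `τ` is killed by `p ^ N`, so on the étale generators it vanishes modulo `𝔪` and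
  -- does not disturb the reduction of `φ 0`.
  have hlift : (baseChange (closedPt R)).map (φ 0 - τ ≫ pTorsionι p T) = u₀ := by
    rw [← hφ₀]
    refine (baseChange_map_eq_of_vanishesMod fun X x => ?_).symm
    rw [sub_sub_cancel]
    refine hℓ.vanishesMod (hv fun a => ?_) x
    rw [hd, ev_zero]
    exact fun z b => map_zero _
  have hbt := btIsoAsExtension_of_families w hE φ hφ σ hσ hσq N _ hd hd'
  refine ⟨_, ⟨hlift, hbt⟩, ?_⟩
  rintro v' ⟨hv₀, hv'⟩
  obtain ⟨g₁, hg₁⟩ := divisible_of_btIsoAsExtension w hE σ hσ hσq τ hτ hbt N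
  obtain ⟨g₂, hg₂⟩ := divisible_of_btIsoAsExtension w hE σ hσ hσq τ hτ hv' N
  -- Both solutions plus the same `τ` are divisible by `p ^ N`, so their difference is `p ^ N` times
  -- a homomorphism, which on generators vanishes modulo `𝔪` because its `p ^ N`-multiple does.
  have hg : p ^ N • (g₂ - g₁) = v' - (φ 0 - τ ≫ pTorsionι p T) := by
    rw [smul_sub, hg₁, hg₂, add_sub_add_right_eq_sub]
  apply hℓ.hom_ext
  intro a
  rw [← sub_eq_zero, ← ev_sub, ← hg, ev_nsmul]
  refine pow_smul_eq_zero_of_vanishesMod e p hN (hv (fun a => ?_) a)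
  rw [hg]
  exact vanishesMod_sub_of_baseChange (hv₀.trans hlift.symm) _
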